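/- Let $N\ge 2$, $n\ge 2$, $t\in[1,2]$ and $\eta\in(0,1)$. For $q\in[0,1]^N$ let $\mathbb P_q$ be the law of $X_1,\dots,X_n$ i.i.d., where the entries of $X_i=(X_i(1),\dots,X_i(N))$ are independent with $X_i(j)\sim\mathrm{Ber}(q_j)$. For $s>0$ put $\|x\|_s=\big(\sum_j|x_j|^s\big)^{1/s}$. For $p\in[0,1]^N$ the $\eta$-minimax separation radius for testing $q=p$ against $\|p-q\|_t\ge\rho$ is $$\rho^*=\rho^*_{p,t,n}(\eta)=\inf\Big\{\rho>0:\ \inf_{\psi}\Big[\mathbb P_p(\psi=1)+\sup_{q\in[0,1]^N:\ \|p-q\|_t\ge\rho}\mathbb P_q(\psi=0)\Big]\le\eta\Big\},$$ where $\psi$ ranges over all tests, that is, measurable $\{0,1\}$-valued functions of $(X_1,\dots,X_n)$, and a supremum over the empty set is $0$. Let $\bar p_1\ge\dots\ge\bar p_N$ be the numbers $\min(p_j,1-p_j)$ in decreasing order (so $\bar p=p$ if $\tfrac12\ge p_1\ge\dots\ge p_N$). For $0\le u\le N$ let $\bar p_{\le u}=(\bar p_1,\dots,\bar p_u,0,\dots,0)$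 and $\bar p_{>u}=(0,\dots,0,\bar p_{u+1},\dots,\bar p_N)$. For $c_I>0$ let $I=\min\{J\ge 0:\ \sum_{i>J}\bar p_i^2\le c_I/n^2\}$, and let $r=2t/(4-t)$. **Theorem.** For every $\eta\in(0,1)$ there is $c_0>0$ such that, for every $c_I\in(0,c_0]$ (fixed as a function of $\eta$) and every $t\in[1,2]$, there are constants $c,C>0$, depending only on $\eta$, $t$ and the choice of $c_I$, such that for all $N\ge2$, all $n\ge 2$ and all $p\in[0,1]^N$, $$c\,\bar\rho\ \le\ \rho^*_{p,t,n}(\eta)\ \le\ C\,\bar\rho,\qquad \bar\rho=\sqrt{\frac{\|\bar p_{\le I}\|_r}{n}}+\frac{\|\bar p_{>I}\|_1^{(2-t)/t}}{n^{(2t-2)/t}}+\frac1n,$$ with the convention $0^0=1$. -/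

import Mathlib

open MeasureTheory ProbabilityTheory

namespace BinomialTesting

noncomputable section

/-- The entrywise `ℓ_s` (quasi-)norm `(∑ j, |x j| ^ s) ^ (1 / s)`, for `s > 0`. -/
def lpNorm {N : ℕ} (s : ℝ) (x : Fin N → ℝ) : ℝ :=
  (∑ j, |x j| ^ s) ^ (1 / s)

/-- The sample space: `n` observations, each a vector of `N` binary entries. -/
abbrev Sample (n N : ℕ) : Type := Fin n → Fin N → Bool

/-- The law of `X₁, …, Xₙ` iid, where the entries of each `Xᵢ` are independent and
`Xᵢ(j) ∼ Ber(q j)`, with `q ∈ [0,1]^N`. -/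
def sampleLaw (n : ℕ) {N : ℕ} (q : Fin N → unitInterval) : Measure (Sample n N) :=
  Measure.pi fun _ : Fin n => Measure.pi fun j : Fin N => bernoulliMeasure true false (q j)

/-- The `ℓ_t` distance between two parameter vectors. -/
def paramDist {N : ℕ} (t : ℝ) (p q : Fin N → unitInterval) : ℝ :=
  lpNorm t fun j => (p j : ℝ) - (q j : ℝ)

/-- A test: a measurable function of the observations with two values; `true` (the value `1`)
means that the null hypothesis is rejected. -/
abbrev Test (n N : ℕ) : Type := {ψ : Sample n N → Bool // Measurable ψ}

/-- The maximum risk of a test `ψ`: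
`P_p(ψ = 1) + sup {P_q(ψ = 0) : q ∈ [0,1]^N, ‖p - q‖_t ≥ ρ}`.
The probabilities lie in `[0,1]`, and the supremum over an empty alternative is `0`. -/
def risk {n N : ℕ} (t ρ : ℝ) (p : Fin N → unitInterval) (ψ : Test n N) : ℝ :=
  (sampleLaw n p).real {x | ψ.1 x = true} +
    ⨆ q : {q : Fin N → unitInterval // ρ ≤ paramDist t p q},
      (sampleLaw n q.1).real {x | ψ.1 x = false}

/-- The minimax risk: the infimum of the maximum risk over all tests. -/
def minimaxRisk (n : ℕ) {N : ℕ} (t ρ : ℝ) (p : Fin N → unitInterval) : ℝ :=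
  ⨅ ψ : Test n N, risk t ρ p ψ

/-- The `η`-minimax separation radius. -/
def separationRadius (n : ℕ) {N : ℕ} (t η : ℝ) (p : Fin N → unitInterval) : ℝ :=
  sInf {ρ : ℝ | 0 < ρ ∧ minimaxRisk n t ρ p ≤ η}

/-- `x_{≤ u}`: the first `u` entries are kept, the others are replaced by `0`.
(The `i`-th entry, `1 ≤ i ≤ N`, has index `i - 1` in `Fin N`.) -/
def head {N : ℕ} (u : ℕ) (x : Fin N → ℝ) : Fin N → ℝ :=
  fun j => if (j : ℕ) < u then x j else 0

/-- `x_{> u}`: the first `u` entries are replaced by `0`, the others are kept. -/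
def tail {N : ℕ} (u : ℕ) (x : Fin N → ℝ) : Fin N → ℝ :=
  fun j => if (j : ℕ) < u then 0 else x j

/-- The smallest `J ≥ 0` with `∑_{i > J} x_i ^ 2 ≤ cI / n ^ 2`
(for `cI ≥ 0` such a `J` exists, e.g. `J = N`). -/
def cutoff (cI : ℝ) (n : ℕ) {N : ℕ} (x : Fin N → ℝ) : ℕ :=
  sInf {J : ℕ | ∑ j, tail J x j ^ 2 ≤ cI / (n : ℝ) ^ 2}

/-- The rate `√(‖x_{≤ I}‖_r / n) + ‖x_{> I}‖_1 ^ ((2-t)/t) / n ^ ((2t-2)/t) + 1 / n`,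
where `r = 2t / (4-t)` and `I = cutoff cI n x`. -/
def rate (cI t : ℝ) (n : ℕ) {N : ℕ} (x : Fin N → ℝ) : ℝ :=
  √(lpNorm (2 * t / (4 - t)) (head (cutoff cI n x) x) / (n : ℝ)) +
    lpNorm 1 (tail (cutoff cI n x) x) ^ ((2 - t) / t) / (n : ℝ) ^ ((2 * t - 2) / t) +
    1 / (n : ℝ)

/-- The null vector after exchanging the roles of `0` and `1` in the coordinates with
`p j > 1/2`, and then listing the coordinates in the order given by `σ`. If all `p j ≤ 1/2`
and `σ` is the identity, this is `p` itself. -/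
def reduced {N : ℕ} (p : Fin N → unitInterval) (σ : Equiv.Perm (Fin N)) : Fin N → ℝ :=
  fun j => min (p (σ j) : ℝ) (1 - (p (σ j) : ℝ))

end

end BinomialTesting

namespace BinomialTesting

noncomputable section

/-! Flipping coordinates with `p j > 1/2` and sorting preserves laws and distances, so let the null
be decreasing with entries at most 1/2. Write S = ∑_{i≤I} p_i^r and T = ∑_{i>I} p_i.

Lower bound: a prior on far alternatives whose mixture is close to the null in total variation
forces a large risk. Shifting one coordinate by order 1/n gives the term 1/n
(`le_minimaxRisk_single`). In the tail, p_j is replaced by 0 or π with mean p_j, where π is of order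
1/(n²T); matching means leave an affinity loss of only n² p_j π per column, which sums to order cI
(`le_minimaxRisk_sparse`). In the head, p_j is replaced by p_j ± γ_j with γ_j proportional to
p_j^{2/(4-t)}; the chi-square cost is of order n² ∑ γ_j⁴/p_j² (`le_minimaxRisk_dense`). This needs
γ_j ≤ p_j, that is, n² S p_I^{2-r} bounded below. When that fails, minimality of I makes n² T p_I
bounded below, and the head term is dominated by the tail term (`le_head_or_le_tail`,
`head_rate_le_tail_rate`).

Upper bound: Chebyshev's inequality for three statistics. The head uses a weighted estimate of
squared deviations, with weights p_j^{-(2-r)/2} matched to Hölder's inequality (`exists_head_test`).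
The tail uses the unweighted version together with the total count of ones: if the squared ℓ_2
deviation is of order at most 1/n², interpolating ℓ_t between ℓ_1 and ℓ_2 forces a large ℓ_1
deviation, which the count detects because the null mass T is small in comparison
(`exists_tail_test`). -/

/-! ### Observations by column and the symmetries of the problem -/

/-- The mass that `Ber(q)` gives to `b`. -/
def bitWeight (q : ℝ) (b : Bool) : ℝ := if b then q else 1 - q

lemma bitWeight_nonneg {q : ℝ} (h0 : 0 ≤ q) (h1 : q ≤ 1) (b : Bool) : 0 ≤ bitWeight q b := by
  unfold bitWeight; split_ifs <;> linarith

lemma bernoulli_real_singleton (q : unitInterval) (b : Bool) :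
    (bernoulliMeasure true false q).real {b} = bitWeight q b := by
  rw [bernoulliMeasure_real_apply _ (measurableSet_singleton b)]
  cases b <;> simp [bitWeight]

lemma pi_real_singleton {ι : Type*} [Fintype ι] {α : ι → Type*} [∀ i, MeasurableSpace (α i)]
    (μ : ∀ i, Measure (α i)) [∀ i, IsProbabilityMeasure (μ i)] (f : ∀ i, α i) :
    (Measure.pi μ).real {f} = ∏ i, (μ i).real {f i} := by
  simp [measureReal_def, ENNReal.toReal_prod]

/-- The law of the observations, arranged by coordinate. -/
def colLaw (n : ℕ) {N : ℕ} (q : Fin N → unitInterval) : Measure (Fin N → Fin n → Bool) :=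
  Measure.pi fun j => Measure.pi fun _ => bernoulliMeasure true false (q j)

instance (n : ℕ) {N : ℕ} (q : Fin N → unitInterval) : IsProbabilityMeasure (colLaw n q) := by
  unfold colLaw; infer_instance

instance (n : ℕ) {N : ℕ} (q : Fin N → unitInterval) : IsProbabilityMeasure (sampleLaw n q) := by
  unfold sampleLaw; infer_instance

/-- The mass function of `n` independent `Ber(q)` variables. -/
def colWeight {n : ℕ} (q : ℝ) (y : Fin n → Bool) : ℝ := ∏ i, bitWeight q (y i)

lemma colWeight_nonneg {n : ℕ} {q : ℝ} (h0 : 0 ≤ q) (h1 : q ≤ 1) (y : Fin n → Bool) :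
    0 ≤ colWeight q y := Finset.prod_nonneg fun _ _ => bitWeight_nonneg h0 h1 _

lemma sum_colWeight {n : ℕ} (q : ℝ) : ∑ y : Fin n → Bool, colWeight q y = 1 := by
  unfold colWeight
  rw [← Fintype.prod_sum (fun (_ : Fin n) (b : Bool) => bitWeight q b)]
  simp [bitWeight]

lemma colLaw_real_singleton (n : ℕ) {N : ℕ} (q : Fin N → unitInterval)
    (y : Fin N → Fin n → Bool) :
    (colLaw n q).real {y} = ∏ j, colWeight (q j) (y j) := by
  simp only [colLaw, pi_real_singleton, bernoulli_real_singleton, colWeight]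

lemma sampleLaw_real_singleton (n : ℕ) {N : ℕ} (q : Fin N → unitInterval) (x : Sample n N) :
    (sampleLaw n q).real {x} = ∏ i, ∏ j, bitWeight (q j) (x i j) := by
  simp only [sampleLaw, pi_real_singleton, bernoulli_real_singleton]

/-- The parameter after exchanging the roles of `0` and `1` if `f` holds. -/
def flipParam (f : Bool) (q : unitInterval) : unitInterval := if f then unitInterval.symm q else q

lemma flipParam_flipParam (f : Bool) (q : unitInterval) : flipParam f (flipParam f q) = q := by
  cases f <;> simp [flipParam]

lemma bitWeight_flipParam (f : Bool) (q : unitInterval) (b : Bool) :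
    bitWeight (flipParam f q) (xor b f) = bitWeight q b := by
  cases f <;> cases b <;> simp [flipParam, bitWeight]

/-- Rearrangement of the observations by coordinate, with the coordinates in the order `σ`, after
exchanging the roles of `0` and `1` where `f` holds. -/
def sampleEquiv (n : ℕ) {N : ℕ} (σ : Equiv.Perm (Fin N)) (f : Fin N → Bool) :
    Sample n N ≃ (Fin N → Fin n → Bool) where
  toFun x j i := xor (x i (σ j)) (f j)
  invFun y i k := xor (y (σ.symm k) i) (f (σ.symm k))
  left_inv x := by ext i k; simp
  right_inv y := by ext j i; simp

/-- The parameters that correspond to each other under `sampleEquiv`. -/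
def paramEquiv {N : ℕ} (σ : Equiv.Perm (Fin N)) (f : Fin N → Bool) :
    (Fin N → unitInterval) ≃ (Fin N → unitInterval) where
  toFun q j := flipParam (f j) (q (σ j))
  invFun q k := flipParam (f (σ.symm k)) (q (σ.symm k))
  left_inv q := by ext k; simp [flipParam_flipParam]
  right_inv q := by ext j; simp [flipParam_flipParam]

lemma real_eq_sum_singleton {α : Type*} [Fintype α] [MeasurableSpace α]
    [MeasurableSingletonClass α] (μ : Measure α) [IsFiniteMeasure μ] (S : Set α)
    [DecidablePred (· ∈ S)] : μ.real S = ∑ x, if x ∈ S then μ.real {x} else 0 := by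
  rw [← Finset.sum_filter]
  have h : S = ⋃ x ∈ Finset.univ.filter (· ∈ S), {x} := by ext; simp
  conv_lhs => rw [h]
  rw [measureReal_biUnion_finset]
  · intro a _ b _ hab; simpa using hab
  · simp

/-- The sample space is finite, so masses of points suffice; flipping a bit together with its
parameter leaves its weight unchanged. -/
lemma sampleLaw_real_preimage {n N : ℕ} (σ : Equiv.Perm (Fin N)) (f : Fin N → Bool)
    (q : Fin N → unitInterval) (S : Set (Fin N → Fin n → Bool)) :
    (sampleLaw n q).real (sampleEquiv n σ f ⁻¹' S) = (colLaw n (paramEquiv σ f q)).real S := by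
  classical
  rw [real_eq_sum_singleton, real_eq_sum_singleton, ← (sampleEquiv n σ f).sum_comp]
  refine Finset.sum_congr rfl fun x _ => ?_
  rw [sampleLaw_real_singleton, colLaw_real_singleton]
  have : ∏ j, colWeight (paramEquiv σ f q j) (sampleEquiv n σ f x j) =
      ∏ i, ∏ j, bitWeight (q j) (x i j) := by
    simp only [colWeight, paramEquiv, sampleEquiv, Equiv.coe_fn_mk, bitWeight_flipParam]
    rw [Finset.prod_comm]
    exact Finset.prod_congr rfl fun i _ => Equiv.prod_comp σ fun k => bitWeight (q k) (x i k)
  rw [this]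
  rfl

lemma paramDist_paramEquiv {N : ℕ} (t : ℝ) (σ : Equiv.Perm (Fin N)) (f : Fin N → Bool)
    (p q : Fin N → unitInterval) :
    paramDist t (paramEquiv σ f p) (paramEquiv σ f q) = paramDist t p q := by
  unfold paramDist lpNorm
  congr 1
  rw [← Equiv.sum_comp σ fun k => |(p k : ℝ) - q k| ^ t]
  refine Finset.sum_congr rfl fun j _ => ?_
  congr 1
  simp only [paramEquiv, Equiv.coe_fn_mk, flipParam]
  split_ifs
  · simp only [unitInterval.coe_symm_eq]
    rw [abs_sub_comm]; congr 1; ring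
  · rfl

/-! ### Bounding the minimax risk and the separation radius -/

lemma risk_nonneg {n N : ℕ} (t ρ : ℝ) (p : Fin N → unitInterval) (ψ : Test n N) :
    0 ≤ risk t ρ p ψ :=
  add_nonneg measureReal_nonneg (Real.iSup_nonneg fun _ => measureReal_nonneg)

/-- A rejection region for the rearranged data pulls back to a test, and `paramEquiv` preserves
`paramDist`, so both error bounds transfer. -/
lemma minimaxRisk_le_of_region {n N : ℕ} (t ρ ε : ℝ) (hε : 0 ≤ ε) (p : Fin N → unitInterval)
    (σ : Equiv.Perm (Fin N)) (f : Fin N → Bool) (R : Set (Fin N → Fin n → Bool))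
    (hR : (colLaw n (paramEquiv σ f p)).real R ≤ ε)
    (hq : ∀ q, ρ ≤ paramDist t (paramEquiv σ f p) q → (colLaw n q).real Rᶜ ≤ ε) :
    minimaxRisk n t ρ p ≤ 2 * ε := by
  classical
  let ψ : Test n N := ⟨fun x => decide (sampleEquiv n σ f x ∈ R), measurable_of_finite _⟩
  have h1 : {x | ψ.1 x = true} = sampleEquiv n σ f ⁻¹' R := by ext x; simp [ψ]
  have h2 : {x | ψ.1 x = false} = sampleEquiv n σ f ⁻¹' Rᶜ := by ext x; simp [ψ]
  have hle : risk t ρ p ψ ≤ 2 * ε := by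
    unfold risk
    rw [h1, h2, sampleLaw_real_preimage, two_mul]
    refine add_le_add hR (Real.iSup_le (fun q => ?_) hε)
    rw [sampleLaw_real_preimage]
    exact hq _ (by rw [paramDist_paramEquiv]; exact q.2)
  exact (ciInf_le ⟨0, by rintro _ ⟨ψ, rfl⟩; exact risk_nonneg t ρ p ψ⟩ ψ).trans hle

/-- A lower bound on the minimax risk by a finite prior: `π` gives mass at most `ε` to parameters
within distance `ρ` of the null parameter, and `δ` bounds the total variation distance between the
null law and the mixture. -/
lemma le_minimaxRisk_of_prior {n N : ℕ} (t ρ ε δ : ℝ) (p : Fin N → unitInterval)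
    (σ : Equiv.Perm (Fin N)) (f : Fin N → Bool) {Ω : Type*} [Fintype Ω]
    (w : Ω → ℝ) (hw : ∀ ω, 0 ≤ w ω) (hw1 : ∑ ω, w ω = 1) (q : Ω → Fin N → unitInterval)
    (good : Ω → Prop) [DecidablePred good]
    (hgood : ∀ ω, good ω → ρ ≤ paramDist t (paramEquiv σ f p) (q ω))
    (hbad : ∑ ω, (if good ω then 0 else w ω) ≤ ε)
    (haff : 1 - δ ≤ ∑ y : Fin N → Fin n → Bool,
      min ((colLaw n (paramEquiv σ f p)).real {y}) (∑ ω, w ω * (colLaw n (q ω)).real {y})) :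
    1 - δ - ε ≤ minimaxRisk n t ρ p := by
  classical
  have : Nonempty (Test n N) := ⟨⟨fun _ => true, measurable_const⟩⟩
  refine le_ciInf fun ψ => ?_
  let R : Set (Fin N → Fin n → Bool) := {y | ψ.1 ((sampleEquiv n σ f).symm y) = true}
  have h1 : {x | ψ.1 x = true} = sampleEquiv n σ f ⁻¹' R := by ext x; simp [R]
  have h2 : {x | ψ.1 x = false} = sampleEquiv n σ f ⁻¹' Rᶜ := by ext x; simp [R]
  unfold risk
  rw [h1, h2, sampleLaw_real_preimage]
  simp only [sampleLaw_real_preimage]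
  set s := ⨆ q : {q : Fin N → unitInterval // ρ ≤ paramDist t p q},
      (colLaw n (paramEquiv σ f q.1)).real Rᶜ with hs
  have hs0 : 0 ≤ s := Real.iSup_nonneg fun _ => measureReal_nonneg
  have hsup : ∀ ω, good ω → (colLaw n (q ω)).real Rᶜ ≤ s := by
    intro ω hω
    have hb : BddAbove (Set.range fun q : {q : Fin N → unitInterval // ρ ≤ paramDist t p q} =>
        (colLaw n (paramEquiv σ f q.1)).real Rᶜ) :=
      ⟨1, by rintro _ ⟨q, rfl⟩; exact measureReal_le_one⟩
    have := le_ciSup hb ⟨(paramEquiv σ f).symm (q ω), by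
      rw [← paramDist_paramEquiv t σ f, Equiv.apply_symm_apply]; exact hgood ω hω⟩
    simpa using this
  have hmix : ∑ ω, w ω * (colLaw n (q ω)).real Rᶜ ≤ s + ε := by
    calc ∑ ω, w ω * (colLaw n (q ω)).real Rᶜ
        ≤ ∑ ω, (w ω * s + if good ω then 0 else w ω) := by
          refine Finset.sum_le_sum fun ω _ => ?_
          split_ifs with h
          · simpa using mul_le_mul_of_nonneg_left (hsup ω h) (hw ω)
          · have := mul_le_mul_of_nonneg_left
              (measureReal_le_one : (colLaw n (q ω)).real Rᶜ ≤ 1) (hw ω)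
            have := mul_nonneg (hw ω) hs0
            linarith
      _ ≤ s + ε := by
          rw [Finset.sum_add_distrib, ← Finset.sum_mul, hw1]; linarith
  have hsum : ∑ y : Fin N → Fin n → Bool,
      min ((colLaw n (paramEquiv σ f p)).real {y}) (∑ ω, w ω * (colLaw n (q ω)).real {y}) ≤
      (colLaw n (paramEquiv σ f p)).real R + ∑ ω, w ω * (colLaw n (q ω)).real Rᶜ := by
    rw [real_eq_sum_singleton _ R]
    have : ∀ ω, w ω * (colLaw n (q ω)).real Rᶜ =
        ∑ y, if y ∈ Rᶜ then w ω * (colLaw n (q ω)).real {y} else 0 := by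
      intro ω
      rw [real_eq_sum_singleton _ Rᶜ, Finset.mul_sum]
      exact Finset.sum_congr rfl fun y _ => by rw [mul_ite, mul_zero]
    simp_rw [this]
    rw [Finset.sum_comm, ← Finset.sum_add_distrib]
    refine Finset.sum_le_sum fun y _ => ?_
    by_cases hy : y ∈ R
    · simp [hy]
    · simp [hy]
  linarith

/-- The pattern of coordinates in which the roles of `0` and `1` are exchanged. -/
def flipPattern {N : ℕ} (p : Fin N → unitInterval) (σ : Equiv.Perm (Fin N)) (j : Fin N) : Bool :=
  decide ((1 : ℝ) / 2 < p (σ j))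

lemma coe_paramEquiv_flipPattern {N : ℕ} (p : Fin N → unitInterval) (σ : Equiv.Perm (Fin N))
    (j : Fin N) : (paramEquiv σ (flipPattern p σ) p j : ℝ) = reduced p σ j := by
  simp only [paramEquiv, Equiv.coe_fn_mk, flipParam, flipPattern, reduced, decide_eq_true_eq]
  split_ifs with h
  · rw [min_eq_right (by linarith)]; simp
  · rw [min_eq_left (by linarith)]

lemma reduced_nonneg {N : ℕ} (p : Fin N → unitInterval) (σ : Equiv.Perm (Fin N)) (j : Fin N) :
    0 ≤ reduced p σ j := le_min (p _).2.1 (by linarith [(p (σ j)).2.2])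

lemma reduced_le_half {N : ℕ} (p : Fin N → unitInterval) (σ : Equiv.Perm (Fin N)) (j : Fin N) :
    reduced p σ j ≤ 1 / 2 := by
  unfold reduced
  rcases le_total (p (σ j) : ℝ) (1 / 2) with h | h
  · exact (min_le_left _ _).trans h
  · exact (min_le_right _ _).trans (by linarith)

lemma separationRadius_le {n N : ℕ} {t η ρ : ℝ} {p : Fin N → unitInterval} (hρ : 0 < ρ)
    (h : minimaxRisk n t ρ p ≤ η) : separationRadius n t η p ≤ ρ :=
  csInf_le ⟨0, fun _ hx => hx.1.le⟩ ⟨hρ, h⟩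

lemma lpNorm_nonneg {N : ℕ} (s : ℝ) (x : Fin N → ℝ) : 0 ≤ lpNorm s x :=
  Real.rpow_nonneg (Finset.sum_nonneg fun _ _ => Real.rpow_nonneg (abs_nonneg _) _) _

lemma lpNorm_rpow {N : ℕ} {s : ℝ} (hs : s ≠ 0) (x : Fin N → ℝ) :
    lpNorm s x ^ s = ∑ j, |x j| ^ s := by
  unfold lpNorm
  rw [← Real.rpow_mul (Finset.sum_nonneg fun _ _ => Real.rpow_nonneg (abs_nonneg _) _),
    one_div_mul_cancel hs, Real.rpow_one]

lemma paramDist_le {N : ℕ} {t : ℝ} (ht : 0 < t) (p q : Fin N → unitInterval) :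
    paramDist t p q ≤ (N : ℝ) ^ (1 / t) := by
  unfold paramDist lpNorm
  refine Real.rpow_le_rpow (Finset.sum_nonneg fun _ _ => by positivity) ?_ (by positivity)
  calc ∑ j, |(p j : ℝ) - q j| ^ t ≤ ∑ _j : Fin N, (1 : ℝ) := by
        refine Finset.sum_le_sum fun j _ => Real.rpow_le_one (abs_nonneg _) ?_ ht.le
        rw [abs_le]
        constructor <;> linarith [(p j).2.1, (p j).2.2, (q j).2.1, (q j).2.2]
    _ = N := by simp

lemma le_separationRadius {n N : ℕ} {t η ρ : ℝ} (ht : 0 < t) (hη : 0 < η)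
    (p : Fin N → unitInterval)
    (h : ∀ ρ', 0 < ρ' → ρ' < ρ → η < minimaxRisk n t ρ' p) : ρ ≤ separationRadius n t η p := by
  have hne : {ρ : ℝ | 0 < ρ ∧ minimaxRisk n t ρ p ≤ η}.Nonempty := by
    have hK : (0 : ℝ) ≤ (N : ℝ) ^ (1 / t) := by positivity
    -- Beyond the diameter of the cube the alternative is empty and never rejecting has risk 0.
    -- Nonemptiness matters: otherwise `sInf` would default to 0.
    refine ⟨(N : ℝ) ^ (1 / t) + 1, by positivity, ?_⟩
    have := minimaxRisk_le_of_region (n := n) t ((N : ℝ) ^ (1 / t) + 1) 0 le_rfl p 1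
      (fun _ => false) ∅ (by simp) fun q hq => by
        have := paramDist_le ht (paramEquiv 1 (fun _ => false) p) q
        linarith
    linarith
  refine le_csInf hne fun ρ' hρ' => ?_
  by_contra hlt
  exact absurd hρ'.2 (not_le.2 (h ρ' hρ'.1 (not_le.1 hlt)))

/-! ### Affinity of the null law and a product mixture -/

/-- A minimum of products dominates the product of the minima, whose sum factorizes. Affinity is
thus controlled factor by factor. -/
lemma prod_sum_min_le {ι : Type*} [Fintype ι] [DecidableEq ι] {α : ι → Type*}
    [∀ i, Fintype (α i)] (P Q : ∀ i, α i → ℝ) (hP : ∀ i y, 0 ≤ P i y) (hQ : ∀ i y, 0 ≤ Q i y) :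
    ∏ i, ∑ y, min (P i y) (Q i y) ≤ ∑ x : ∀ i, α i, min (∏ i, P i (x i)) (∏ i, Q i (x i)) := by
  rw [Fintype.prod_sum]
  refine Finset.sum_le_sum fun x _ => le_min ?_ ?_
  · exact Finset.prod_le_prod (fun i _ => le_min (hP _ _) (hQ _ _)) fun i _ => min_le_left _ _
  · exact Finset.prod_le_prod (fun i _ => le_min (hP _ _) (hQ _ _)) fun i _ => min_le_right _ _

/-- Weierstrass's product inequality: the losses `δ i` at most add up. -/
lemma one_sub_sum_le_prod {ι : Type*} (s : Finset ι) (a δ : ι → ℝ) (h0 : ∀ i ∈ s, 0 ≤ a i)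
    (h1 : ∀ i ∈ s, a i ≤ 1) (h : ∀ i ∈ s, 1 - δ i ≤ a i) : 1 - ∑ i ∈ s, δ i ≤ ∏ i ∈ s, a i := by
  classical
  induction s using Finset.induction_on with
  | empty => simp
  | insert i s hi ih =>
    have ih := ih (fun k hk => h0 k (Finset.mem_insert_of_mem hk))
      (fun k hk => h1 k (Finset.mem_insert_of_mem hk))
      (fun k hk => h k (Finset.mem_insert_of_mem hk))
    have hp0 : 0 ≤ ∏ k ∈ s, a k :=
      Finset.prod_nonneg fun k hk => h0 k (Finset.mem_insert_of_mem hk)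
    have hp1 : ∏ k ∈ s, a k ≤ 1 :=
      Finset.prod_le_one (fun k hk => h0 k (Finset.mem_insert_of_mem hk))
        fun k hk => h1 k (Finset.mem_insert_of_mem hk)
    rw [Finset.sum_insert hi, Finset.prod_insert hi]
    have e0 := h0 i (Finset.mem_insert_self _ _)
    have e1 := h1 i (Finset.mem_insert_self _ _)
    have e2 := h i (Finset.mem_insert_self _ _)
    nlinarith

/-- The affinity of two mass functions is bounded below by their chi-square divergence. -/
lemma one_sub_sqrt_le_sum_min {α : Type*} [Fintype α] (P Q : α → ℝ) (hP : ∀ y, 0 ≤ P y)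
    (hP1 : ∑ y, P y = 1) (hQ1 : ∑ y, Q y = 1) (hPQ : ∀ y, P y = 0 → Q y = 0) {X : ℝ}
    (hX : ∑ y, Q y ^ 2 / P y ≤ X) : 1 - √(X - 1) / 2 ≤ ∑ y, min (P y) (Q y) := by
  have h1 : ∑ y, min (P y) (Q y) = 1 - (∑ y, |P y - Q y|) / 2 := by
    have : ∀ y, min (P y) (Q y) = P y / 2 + Q y / 2 - |P y - Q y| / 2 := fun y => by
      rcases le_total (P y) (Q y) with h | h
      · rw [min_eq_left h, abs_of_nonpos (by linarith)]; ring
      · rw [min_eq_right h, abs_of_nonneg (by linarith)]; ring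
    simp_rw [this]
    rw [Finset.sum_sub_distrib, Finset.sum_add_distrib, ← Finset.sum_div, ← Finset.sum_div,
      ← Finset.sum_div, hP1, hQ1]
    norm_num
  have h2 : (∑ y, |P y - Q y|) ^ 2 ≤ (∑ y, P y) * ∑ y, (P y - Q y) ^ 2 / P y := by
    refine Finset.sum_sq_le_sum_mul_sum_of_sq_le_mul _ (fun y _ => hP y)
      (fun y _ => div_nonneg (sq_nonneg _) (hP y)) fun y _ => ?_
    rw [sq_abs]
    rcases eq_or_ne (P y) 0 with h | h
    · simp [h, hPQ y h]
    · rw [mul_div_cancel₀ _ h]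
  have h3 : ∑ y, (P y - Q y) ^ 2 / P y = ∑ y, Q y ^ 2 / P y - 1 := by
    have : ∀ y, (P y - Q y) ^ 2 / P y = P y - 2 * Q y + Q y ^ 2 / P y := fun y => by
      rcases eq_or_ne (P y) 0 with h | h
      · simp [h, hPQ y h]
      · field_simp; ring
    simp_rw [this]
    rw [Finset.sum_add_distrib, Finset.sum_sub_distrib, ← Finset.mul_sum, hP1, hQ1]
    ring
  rw [hP1, one_mul, h3] at h2
  have h4 : ∑ y, |P y - Q y| ≤ √(X - 1) := Real.le_sqrt_of_sq_le (by linarith)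
  rw [h1]; linarith

/-- The mass function of a column whose parameter is `b` with probability `θ`, otherwise `a`. -/
def mixWeight {n : ℕ} (θ a b : ℝ) (y : Fin n → Bool) : ℝ :=
  θ * colWeight b y + (1 - θ) * colWeight a y

lemma sum_mixWeight {n : ℕ} (θ a b : ℝ) : ∑ y : Fin n → Bool, mixWeight θ a b y = 1 := by
  simp [mixWeight, Finset.sum_add_distrib, ← Finset.mul_sum, sum_colWeight]

lemma mixWeight_nonneg {n : ℕ} (θ a b : unitInterval) (y : Fin n → Bool) :
    0 ≤ mixWeight θ a b y :=
  add_nonneg (mul_nonneg θ.2.1 (colWeight_nonneg b.2.1 b.2.2 y))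
    (mul_nonneg (sub_nonneg.2 θ.2.2) (colWeight_nonneg a.2.1 a.2.2 y))

/-- The parameter with entries `b j` where `ω j` holds, and `a j` elsewhere. -/
def choice {N : ℕ} (a b : Fin N → unitInterval) (ω : Fin N → Bool) : Fin N → unitInterval :=
  fun j => if ω j then b j else a j

lemma sum_prod_mul_colLaw_choice {n N : ℕ} (θ a b : Fin N → unitInterval)
    (y : Fin N → Fin n → Bool) :
    ∑ ω : Fin N → Bool, (∏ j, bitWeight (θ j) (ω j)) * (colLaw n (choice a b ω)).real {y} =
      ∏ j, mixWeight (θ j) (a j) (b j) (y j) := by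
  simp only [colLaw_real_singleton, ← Finset.prod_mul_distrib]
  have : ∀ j, mixWeight (θ j) (a j) (b j) (y j) = ∑ c : Bool, bitWeight (θ j) c *
      colWeight ((if c then b j else a j : unitInterval) : ℝ) (y j) := fun j => by
    simp [mixWeight, bitWeight]
  simp_rw [this]
  rw [Fintype.prod_sum]
  rfl

/-- A lower bound on the minimax risk by a product of two-point priors, in terms of the affinity
of the null law and the mixture. -/
lemma le_minimaxRisk_of_choice {n N : ℕ} (t ρ ε δ : ℝ) (p : Fin N → unitInterval)
    (σ : Equiv.Perm (Fin N)) (f : Fin N → Bool) (θ a b : Fin N → unitInterval)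
    (good : (Fin N → Bool) → Prop) [DecidablePred good]
    (hgood : ∀ ω, good ω → ρ ≤ paramDist t (paramEquiv σ f p) (choice a b ω))
    (hbad : ∑ ω : Fin N → Bool, (if good ω then 0 else ∏ j, bitWeight (θ j) (ω j)) ≤ ε)
    (haff : 1 - δ ≤ ∑ y : Fin N → Fin n → Bool,
      min (∏ j, colWeight (paramEquiv σ f p j) (y j))
        (∏ j, mixWeight (θ j) (a j) (b j) (y j))) :
    1 - δ - ε ≤ minimaxRisk n t ρ p := by
  refine le_minimaxRisk_of_prior t ρ ε δ p σ f (fun ω : Fin N → Bool => ∏ j, bitWeight (θ j) (ω j))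
    (fun ω => Finset.prod_nonneg fun j _ => bitWeight_nonneg (θ j).2.1 (θ j).2.2 _) ?_
    (choice a b) good hgood hbad ?_
  · rw [← Fintype.prod_sum (fun (j : Fin N) (c : Bool) => bitWeight (θ j) c)]
    simp [bitWeight]
  · simp only [sum_prod_mul_colLaw_choice]
    simpa only [colLaw_real_singleton] using haff

/-- Serves the single shift and the sparse prior, where the columnwise losses have a small sum. -/
lemma le_sum_min_of_column {n N : ℕ} (p θ a b : Fin N → unitInterval) (δ : Fin N → ℝ)
    (h : ∀ j, 1 - δ j ≤ ∑ y : Fin n → Bool,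
      min (colWeight (p j) y) (mixWeight (θ j) (a j) (b j) y)) :
    1 - ∑ j, δ j ≤ ∑ y : Fin N → Fin n → Bool,
      min (∏ j, colWeight (p j) (y j)) (∏ j, mixWeight (θ j) (a j) (b j) (y j)) := by
  have hP : ∀ (j : Fin N) (y : Fin n → Bool), 0 ≤ colWeight (p j) y := fun j y =>
    colWeight_nonneg (p j).2.1 (p j).2.2 y
  refine le_trans ?_ (prod_sum_min_le (fun j y => colWeight (p j) y)
    (fun j y => mixWeight (θ j) (a j) (b j) y) hP fun j y => mixWeight_nonneg _ _ _ _)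
  refine one_sub_sum_le_prod _ _ _ (fun j _ => ?_) (fun j _ => ?_) fun j _ => h j
  · exact Finset.sum_nonneg fun y _ => le_min (hP j y) (mixWeight_nonneg _ _ _ _)
  · exact (Finset.sum_le_sum fun y _ => min_le_left _ _).trans (sum_colWeight _).le

/-- Serves the dense prior, for which adding total variations is too lossy. Chi-square factors
multiply, so the exponents `x j` add and the square root is taken only once. -/
lemma le_sum_min_of_chiSq {n N : ℕ} (p θ a b : Fin N → unitInterval) (x : Fin N → ℝ)
    (h0 : ∀ j (y : Fin n → Bool), colWeight (p j) y = 0 → mixWeight (θ j) (a j) (b j) y = 0)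
    (h : ∀ j, ∑ y : Fin n → Bool, mixWeight (θ j) (a j) (b j) y ^ 2 / colWeight (p j) y ≤
      Real.exp (x j)) :
    1 - √(Real.exp (∑ j, x j) - 1) / 2 ≤ ∑ y : Fin N → Fin n → Bool,
      min (∏ j, colWeight (p j) (y j)) (∏ j, mixWeight (θ j) (a j) (b j) (y j)) := by
  have hP : ∀ (j : Fin N) (y : Fin n → Bool), 0 ≤ colWeight (p j) y := fun j y =>
    colWeight_nonneg (p j).2.1 (p j).2.2 y
  refine one_sub_sqrt_le_sum_min (fun y : Fin N → Fin n → Bool => ∏ j, colWeight (p j) (y j))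
    (fun y => ∏ j, mixWeight (θ j) (a j) (b j) (y j)) (fun y => Finset.prod_nonneg fun j _ => hP _ _)
    ?_ ?_ ?_ ?_
  · rw [← Fintype.prod_sum (fun (j : Fin N) (y : Fin n → Bool) => colWeight (p j) y)]
    simp [sum_colWeight]
  · rw [← Fintype.prod_sum (fun (j : Fin N) (y : Fin n → Bool) => mixWeight (θ j) (a j) (b j) y)]
    simp [sum_mixWeight]
  · intro y hy
    obtain ⟨j, hj, hj0⟩ := Finset.prod_eq_zero_iff.1 hy
    exact Finset.prod_eq_zero hj (h0 j _ hj0)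
  · simp only [← Finset.prod_pow, ← Finset.prod_div_distrib]
    rw [← Fintype.prod_sum (fun (j : Fin N) (y : Fin n → Bool) =>
      mixWeight (θ j) (a j) (b j) y ^ 2 / colWeight (p j) y), Real.exp_sum]
    exact Finset.prod_le_prod (fun j _ => Finset.sum_nonneg fun y _ =>
      div_nonneg (sq_nonneg _) (hP j y)) fun j _ => h j

lemma mixWeight_self {n : ℕ} (θ a : ℝ) (y : Fin n → Bool) :
    mixWeight θ a a y = colWeight a y := by
  unfold mixWeight; ring

lemma sum_min_mixWeight_self {n : ℕ} (θ a : ℝ) :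
    ∑ y : Fin n → Bool, min (colWeight a y) (mixWeight θ a a y) = 1 := by
  simp [mixWeight_self, sum_colWeight]

/-- A single draw has affinity `1 - (q - p)`; Bernoulli's inequality handles the `n`-th power. -/
lemma sum_min_colWeight_of_le {n : ℕ} {p q : ℝ} (hp : 0 ≤ p) (hpq : p ≤ q) (hq : q ≤ 1) :
    1 - n * (q - p) ≤ ∑ y : Fin n → Bool, min (colWeight p y) (colWeight q y) := by
  refine le_trans ?_ (prod_sum_min_le (fun (_ : Fin n) => bitWeight p) (fun _ => bitWeight q)
    (fun _ => bitWeight_nonneg hp (hpq.trans hq)) (fun _ => bitWeight_nonneg (hp.trans hpq) hq))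
  have : ∑ b, min (bitWeight p b) (bitWeight q b) = 1 - (q - p) := by
    simp [bitWeight, min_eq_left hpq, min_eq_right (sub_le_sub_left hpq 1)]; ring
  rw [Finset.prod_const, this, Finset.card_univ, Fintype.card_fin]
  have := one_add_mul_le_pow (a := -(q - p)) (by linarith) n
  simp only [← sub_eq_add_neg, mul_neg] at this
  exact this

/-- The observation without any one, or with a single one. -/
def atMostOne {n : ℕ} : Option (Fin n) → Fin n → Bool
  | none => fun _ => false
  | some i => fun k => decide (k = i)

lemma atMostOne_injective {n : ℕ} : Function.Injective (atMostOne (n := n)) := by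
  rintro (_ | i) (_ | k) h
  · rfl
  · have := congrFun h k; simp [atMostOne] at this
  · have := congrFun h i; simp [atMostOne] at this
  · have := congrFun h i; simp [atMostOne] at this; simp [this]

lemma colWeight_atMostOne_none {n : ℕ} (q : ℝ) :
    colWeight q (atMostOne (n := n) none) = (1 - q) ^ n := by
  simp [colWeight, atMostOne, bitWeight]

lemma colWeight_atMostOne_some {n : ℕ} (q : ℝ) (i : Fin n) :
    colWeight q (atMostOne (some i)) = q * (1 - q) ^ (n - 1) := by
  unfold colWeight
  rw [← Finset.mul_prod_erase _ _ (Finset.mem_univ i)]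
  have : ∀ k ∈ Finset.univ.erase i, bitWeight q (atMostOne (some i) k) = 1 - q := fun k hk => by
    simp [atMostOne, bitWeight, Finset.ne_of_mem_erase hk]
  rw [Finset.prod_congr rfl this]
  simp [atMostOne, bitWeight]

/-- The affinity of `n` observations with parameter `p`, and with a parameter that is `0` or `q`
and has mean `p`. -/
lemma sum_min_sparse {n : ℕ} {p q : ℝ} (hp : 0 ≤ p) (hpq : p ≤ q) (hq0 : 0 < q) (hq : q ≤ 1) :
    1 - (n : ℝ) ^ 2 * (p * q) ≤
      ∑ y : Fin n → Bool, min (colWeight p y) (mixWeight (p / q) 0 q y) := by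
  have hθ1 : p / q ≤ 1 := (div_le_one hq0).2 hpq
  have hθ0 : 0 ≤ p / q := by positivity
  have hθ : p / q * q = p := div_mul_cancel₀ _ hq0.ne'
  have bern : ∀ (k : ℕ) (x : ℝ), x ≤ 1 → 1 - k * x ≤ (1 - x) ^ k := fun k x hx => by
    have := one_add_mul_le_pow (a := -x) (by linarith) k
    simp only [← sub_eq_add_neg, mul_neg] at this
    exact this
  have h0 : ∀ y : Fin n → Bool, 0 ≤ min (colWeight p y) (mixWeight (p / q) 0 q y) := fun y =>
    le_min (colWeight_nonneg hp (hpq.trans hq) y)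
      (add_nonneg (mul_nonneg hθ0 (colWeight_nonneg hq0.le hq y))
        (mul_nonneg (by linarith) (colWeight_nonneg le_rfl zero_le_one y)))
  -- Outcomes with two or more ones are discarded. What remains is at least `(1 - n p) + n p (1 - n
  -- q) = 1 - n² p q`; the first-order terms cancel since the mixture has mean `p`.
  have h1 : ∑ o : Option (Fin n), min (colWeight p (atMostOne o))
      (mixWeight (p / q) 0 q (atMostOne o)) ≤
      ∑ y : Fin n → Bool, min (colWeight p y) (mixWeight (p / q) 0 q y) := by
    refine (Finset.sum_map Finset.univ ⟨atMostOne, atMostOne_injective⟩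
      (fun y : Fin n → Bool => min (colWeight p y) (mixWeight (p / q) 0 q y))).symm.trans_le ?_
    exact Finset.sum_le_sum_of_subset_of_nonneg (Finset.subset_univ _) fun y _ _ => h0 y
  refine le_trans ?_ h1
  rw [Fintype.sum_option]
  have hnone : 1 - n * p ≤ min (colWeight p (atMostOne (n := n) none))
      (mixWeight (p / q) 0 q (atMostOne (n := n) none)) := by
    simp only [mixWeight, colWeight_atMostOne_none]
    refine le_min (bern n p (hpq.trans hq)) ?_
    have := mul_le_mul_of_nonneg_left (bern n q hq) hθ0
    have e : p / q * (1 - n * q) = p / q - n * p := by linear_combination (-(n : ℝ)) * hθ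
    simp only [sub_zero, one_pow, mul_one]
    linarith
  have hsome : ∀ i : Fin n, p * (1 - n * q) ≤ min (colWeight p (atMostOne (some i)))
      (mixWeight (p / q) 0 q (atMostOne (some i))) := by
    intro i
    simp only [mixWeight, colWeight_atMostOne_some]
    have hn : ((n - 1 : ℕ) : ℝ) ≤ n := by exact_mod_cast Nat.sub_le n 1
    have k1 : 1 - n * q ≤ (1 - q) ^ (n - 1) :=
      le_trans (by nlinarith) (bern (n - 1) q hq)
    have k2 : (1 - q) ^ (n - 1) ≤ (1 - p) ^ (n - 1) :=
      pow_le_pow_left₀ (by linarith) (by linarith) _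
    refine le_min (mul_le_mul_of_nonneg_left (k1.trans k2) hp) ?_
    rw [← mul_assoc, hθ]
    simpa using mul_le_mul_of_nonneg_left k1 hp
  have hs := Finset.sum_le_sum fun (i : Fin n) (_ : i ∈ Finset.univ) => hsome i
  rw [Finset.sum_const, Finset.card_univ, Fintype.card_fin, nsmul_eq_mul] at hs
  nlinarith

/-- The sum factorizes over the draws; in each factor the terms linear in `u` and `v` cancel. -/
lemma sum_colWeight_mul_div {n : ℕ} {p : ℝ} (hp0 : p ≠ 0) (hp1 : 1 - p ≠ 0) (u v : ℝ) :
    ∑ y : Fin n → Bool, colWeight (p + u) y * colWeight (p + v) y / colWeight p y =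
      (1 + u * v / (p * (1 - p))) ^ n := by
  simp only [colWeight, ← Finset.prod_mul_distrib, ← Finset.prod_div_distrib]
  rw [← Fintype.prod_sum (fun (_ : Fin n) (b : Bool) =>
    bitWeight (p + u) b * bitWeight (p + v) b / bitWeight p b), Finset.prod_const,
    Finset.card_univ, Fintype.card_fin]
  congr 1
  simp only [Fintype.sum_bool, bitWeight, if_true, Bool.false_eq_true, if_false]
  field_simp
  ring

/-- The chi-square divergence of a column whose parameter is perturbed symmetrically. -/
lemma chiSq_symmetric {n : ℕ} {p γ : ℝ} (hp0 : 0 < p) (hp : p ≤ 1 / 2) (hγ0 : 0 ≤ γ)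
    (hγ : γ ≤ p) :
    ∑ y : Fin n → Bool, mixWeight (1 / 2) (p - γ) (p + γ) y ^ 2 / colWeight p y ≤
      Real.exp (2 * (n : ℝ) ^ 2 * (γ ^ 4 / p ^ 2)) := by
  set a := γ ^ 2 / (p * (1 - p)) with ha
  have hp1 : 0 < 1 - p := by linarith
  have hpp : 0 < p * (1 - p) := by positivity
  have ha0 : 0 ≤ a := by positivity
  have ha2 : a ≤ 2 * (γ ^ 2 / p) := by
    rw [ha, ← mul_div_assoc, div_le_div_iff₀ hpp hp0]
    have : 0 ≤ γ ^ 2 * p := by positivity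
    nlinarith
  have ha1 : a ≤ 1 := by
    rw [ha, div_le_one hpp]
    nlinarith
  have h1 : ∑ y : Fin n → Bool, mixWeight (1 / 2) (p - γ) (p + γ) y ^ 2 / colWeight p y =
      ((1 + a) ^ n + (1 - a) ^ n) / 2 := by
    have e : ∀ y : Fin n → Bool,
        mixWeight (1 / 2) (p - γ) (p + γ) y ^ 2 / colWeight p y =
        1 / 4 * (colWeight (p + γ) y * colWeight (p + γ) y / colWeight p y) +
        1 / 2 * (colWeight (p + γ) y * colWeight (p + -γ) y / colWeight p y) +
        1 / 4 * (colWeight (p + -γ) y * colWeight (p + -γ) y / colWeight p y) := fun y => by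
      unfold mixWeight; rw [← sub_eq_add_neg]; ring
    simp_rw [e]
    rw [Finset.sum_add_distrib, Finset.sum_add_distrib, ← Finset.mul_sum, ← Finset.mul_sum,
      ← Finset.mul_sum, sum_colWeight_mul_div hp0.ne' hp1.ne',
      sum_colWeight_mul_div hp0.ne' hp1.ne', sum_colWeight_mul_div hp0.ne' hp1.ne']
    have e1 : γ * γ / (p * (1 - p)) = a := by rw [ha, sq]
    have e2 : -γ * -γ / (p * (1 - p)) = a := by rw [ha]; ring
    have e3 : γ * -γ / (p * (1 - p)) = -a := by rw [ha]; ring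
    rw [e1, e2, e3]; ring
  have h2 : (1 + a) ^ n ≤ Real.exp (n * a) := by
    rw [Real.exp_nat_mul]
    exact pow_le_pow_left₀ (by linarith) (by linarith [Real.add_one_le_exp a]) _
  have h3 : (1 - a) ^ n ≤ Real.exp (-(n * a)) := by
    rw [← mul_neg, Real.exp_nat_mul]
    exact pow_le_pow_left₀ (by linarith) (by linarith [Real.add_one_le_exp (-a)]) _
  -- The symmetric perturbation leaves an average bounded by `cosh (n a)`, so the exponent is
  -- quadratic in `n a` rather than linear.
  have h4 := Real.cosh_le_exp_half_sq (n * a)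
  rw [Real.cosh_eq] at h4
  rw [h1]
  calc ((1 + a) ^ n + (1 - a) ^ n) / 2 ≤ Real.exp ((n * a) ^ 2 / 2) := by linarith
    _ ≤ _ := by
      rw [Real.exp_le_exp]
      have : a ^ 2 ≤ (2 * (γ ^ 2 / p)) ^ 2 := pow_le_pow_left₀ ha0 ha2 2
      have e : (2 * (γ ^ 2 / p)) ^ 2 = 4 * (γ ^ 4 / p ^ 2) := by ring
      rw [e] at this
      rw [mul_pow]
      nlinarith [sq_nonneg (n : ℝ)]

/-! ### Comparing powers in logarithmic coordinates -/

/-- Once all positive quantities are written as exponentials, inequalities between products of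
powers become linear and follow from explicit nonnegative combinations of the hypotheses. -/
lemma exists_eq_exp {x : ℝ} (hx : 0 < x) : ∃ s, x = Real.exp s := ⟨_, (Real.exp_log hx).symm⟩

lemma exp_sq (x : ℝ) : Real.exp x ^ 2 = Real.exp (2 * x) := by
  rw [← Real.exp_nat_mul]; norm_num

lemma sqrt_exp (x : ℝ) : √(Real.exp x) = Real.exp (x / 2) := (Real.exp_half x).symm

/-- Covers the case in which the dense prior is unavailable; `y` is to be the smallest head entry.
-/
lemma head_rate_le_tail_rate {t S T y n c : ℝ} (ht1 : 1 ≤ t) (ht2 : t ≤ 2) (hS : 0 < S)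
    (hT : 0 < T) (hy : 0 < y) (hn : 0 < n) (hc : 0 < c)
    (h1 : n ^ 2 * S * y ^ (2 - 2 * t / (4 - t)) ≤ c) (h2 : c ≤ n ^ 2 * T * y) :
    √(S ^ (1 / (2 * t / (4 - t))) / n) ≤
      c ^ ((3 * t - 4) / (4 * t)) * (T ^ ((2 - t) / t) / n ^ ((2 * t - 2) / t)) := by
  obtain ⟨s, rfl⟩ := exists_eq_exp hS
  obtain ⟨τ, rfl⟩ := exists_eq_exp hT
  obtain ⟨y, rfl⟩ := exists_eq_exp hy
  obtain ⟨ν, rfl⟩ := exists_eq_exp hn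
  obtain ⟨γ, rfl⟩ := exists_eq_exp hc
  simp only [exp_sq, ← Real.exp_mul, ← Real.exp_add, ← Real.exp_sub, sqrt_exp,
    Real.exp_le_exp] at *
  have h4 : 0 < 4 - t := by linarith
  have ht : 0 < t := by linarith
  have e : γ * ((3 * t - 4) / (4 * t)) + (τ * ((2 - t) / t) - ν * ((2 * t - 2) / t)) -
      (s * (1 / (2 * t / (4 - t))) - ν) / 2 =
      (4 - t) / (4 * t) * (γ - (2 * ν + s + y * (2 - 2 * t / (4 - t)))) +
      (2 - t) / t * (2 * ν + τ + y - γ) := by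
    field_simp; ring
  have p1 : 0 ≤ (4 - t) / (4 * t) * (γ - (2 * ν + s + y * (2 - 2 * t / (4 - t)))) :=
    mul_nonneg (by positivity) (by linarith)
  have p2 : 0 ≤ (2 - t) / t * (2 * ν + τ + y - γ) :=
    mul_nonneg (div_nonneg (by linarith) ht.le) (by linarith)
  linarith

/-- `h` is the outcome of Hölder's inequality on the head. Solved for `D`, it gives a signal to be
compared with `√S`, the null scale of the head statistic. -/
lemma sq_mul_sqrt_div_le {t S n K D : ℝ} (ht1 : 1 ≤ t) (ht2 : t ≤ 2) (hS : 0 < S) (hn : 0 < n)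
    (hK : 0 < K) (hD : 0 < D)
    (h : (K * √(S ^ (1 / (2 * t / (4 - t))) / n)) ^ t ≤ D ^ (t / 2) * S ^ (1 - t / 2)) :
    K ^ 2 * (√S / n) ≤ D := by
  obtain ⟨s, rfl⟩ := exists_eq_exp hS
  obtain ⟨ν, rfl⟩ := exists_eq_exp hn
  obtain ⟨κ, rfl⟩ := exists_eq_exp hK
  obtain ⟨d, rfl⟩ := exists_eq_exp hD
  simp only [exp_sq, ← Real.exp_mul, ← Real.exp_add, ← Real.exp_sub, sqrt_exp,
    Real.exp_le_exp] at *
  have h4 : 0 < 4 - t := by linarith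
  have ht : 0 < t := by linarith
  have e : d - (2 * κ + (s / 2 - ν)) = 2 / t * (d * (t / 2) + s * (1 - t / 2) -
      (κ + (s * (1 / (2 * t / (4 - t))) - ν) / 2) * t) := by
    field_simp; ring
  have : 0 ≤ 2 / t * (d * (t / 2) + s * (1 - t / 2) -
      (κ + (s * (1 / (2 * t / (4 - t))) - ν) / 2) * t) :=
    mul_nonneg (by positivity) (by linarith)
  linarith

/-- With `y` the smallest head entry, its negative power here is the largest weight of the head
statistic. Under `h1` the head term alone does not control it, but the tail term does. -/
lemma weight_le_of_tail_rate {t S T y n c K D : ℝ} (ht1 : 1 ≤ t) (ht2 : t ≤ 2) (hS : 0 < S)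
    (hT : 0 < T) (hy : 0 < y) (hn : 0 < n) (hc : 0 < c) (hK : 0 < K) (hD : 0 < D)
    (h1 : n ^ 2 * S * y ^ (2 - 2 * t / (4 - t)) ≤ c) (h2 : c ≤ n ^ 2 * T * y)
    (h : (K * (T ^ ((2 - t) / t) / n ^ ((2 * t - 2) / t))) ^ t ≤ D ^ (t / 2) * S ^ (1 - t / 2)) :
    K ^ 2 * c ^ ((2 - t) / t) * (y ^ (-((2 - 2 * t / (4 - t)) / 2)) / n ^ 2) ≤ D := by
  obtain ⟨s, rfl⟩ := exists_eq_exp hS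
  obtain ⟨τ, rfl⟩ := exists_eq_exp hT
  obtain ⟨y, rfl⟩ := exists_eq_exp hy
  obtain ⟨ν, rfl⟩ := exists_eq_exp hn
  obtain ⟨γ, rfl⟩ := exists_eq_exp hc
  obtain ⟨κ, rfl⟩ := exists_eq_exp hK
  obtain ⟨d, rfl⟩ := exists_eq_exp hD
  simp only [exp_sq, ← Real.exp_mul, ← Real.exp_add, ← Real.exp_sub, Real.exp_le_exp] at *
  have h4 : 0 < 4 - t := by linarith
  have ht : 0 < t := by linarith
  have e : d - (2 * κ + γ * ((2 - t) / t) + (y * (-((2 - 2 * t / (4 - t)) / 2)) - 2 * ν)) =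
      2 / t * ((d * (t / 2) + s * (1 - t / 2)) -
        (κ + (τ * ((2 - t) / t) - ν * ((2 * t - 2) / t))) * t) +
      (2 - t) / t * (γ - (2 * ν + s + y * (2 - 2 * t / (4 - t)))) +
      2 * (2 - t) / t * (2 * ν + τ + y - γ) := by
    field_simp; ring
  have h2t : 0 ≤ 2 - t := by linarith
  have p1 : 0 ≤ (2 - t) / t * (γ - (2 * ν + s + y * (2 - 2 * t / (4 - t)))) :=
    mul_nonneg (by positivity) (by linarith)
  have p2 : 0 ≤ 2 * (2 - t) / t * (2 * ν + τ + y - γ) :=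
    mul_nonneg (by positivity) (by linarith)
  have p3 : 0 ≤ 2 / t * ((d * (t / 2) + s * (1 - t / 2)) -
        (κ + (τ * ((2 - t) / t) - ν * ((2 * t - 2) / t))) * t) :=
    mul_nonneg (by positivity) (by linarith)
  linarith

/-- The opposite case: under `h1` the quantity `√S / n` already dominates the largest weight divided
by `n²`. -/
lemma weight_le_of_head_rate {a S y n c K D : ℝ} (hS : 0 < S) (hy : 0 < y) (hn : 0 < n)
    (hc : 0 < c) (h1 : c ≤ n ^ 2 * S * y ^ a) (h : K ^ 2 * (√S / n) ≤ D) :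
    K ^ 2 * √c * (y ^ (-(a / 2)) / n ^ 2) ≤ D := by
  have h2 : √c * (y ^ (-(a / 2)) / n ^ 2) ≤ √S / n := by
    clear h
    obtain ⟨s, rfl⟩ := exists_eq_exp hS
    obtain ⟨y, rfl⟩ := exists_eq_exp hy
    obtain ⟨ν, rfl⟩ := exists_eq_exp hn
    obtain ⟨γ, rfl⟩ := exists_eq_exp hc
    simp only [exp_sq, ← Real.exp_mul, ← Real.exp_add, ← Real.exp_sub, sqrt_exp,
      Real.exp_le_exp] at *
    linarith
  rw [mul_assoc]
  exact (mul_le_mul_of_nonneg_left h2 (sq_nonneg K)).trans h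

/-! ### Head, tail and the cutoff -/

/-- The first `I` coordinates. -/
def headSet (N I : ℕ) : Finset (Fin N) := Finset.univ.filter fun j => (j : ℕ) < I

/-- The coordinates after the first `I`. -/
def tailSet (N I : ℕ) : Finset (Fin N) := Finset.univ.filter fun j => ¬ (j : ℕ) < I

@[simp] lemma mem_headSet {N I : ℕ} {j : Fin N} : j ∈ headSet N I ↔ (j : ℕ) < I := by
  simp [headSet]

@[simp] lemma mem_tailSet {N I : ℕ} {j : Fin N} : j ∈ tailSet N I ↔ I ≤ (j : ℕ) := by
  simp [tailSet]

lemma sum_headSet_add_sum_tailSet {N : ℕ} (I : ℕ) (f : Fin N → ℝ) :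
    ∑ j ∈ headSet N I, f j + ∑ j ∈ tailSet N I, f j = ∑ j, f j :=
  Finset.sum_filter_add_sum_filter_not _ _ _

lemma lpNorm_head {N : ℕ} {s : ℝ} (hs : s ≠ 0) (I : ℕ) {x : Fin N → ℝ} (hx : ∀ j, 0 ≤ x j) :
    lpNorm s (head I x) = (∑ j ∈ headSet N I, x j ^ s) ^ (1 / s) := by
  unfold lpNorm head headSet
  rw [Finset.sum_filter]
  congr 1
  refine Finset.sum_congr rfl fun j _ => ?_
  split_ifs
  · rw [abs_of_nonneg (hx j)]
  · rw [abs_zero, Real.zero_rpow hs]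

lemma lpNorm_one_tail {N : ℕ} (I : ℕ) {x : Fin N → ℝ} (hx : ∀ j, 0 ≤ x j) :
    lpNorm 1 (tail I x) = ∑ j ∈ tailSet N I, x j := by
  unfold lpNorm tail tailSet
  rw [Finset.sum_filter, div_one, Real.rpow_one]
  refine Finset.sum_congr rfl fun j _ => ?_
  rw [Real.rpow_one, ite_not]
  split_ifs
  · simp
  · rw [abs_of_nonneg (hx j)]

lemma sum_tail_sq {N : ℕ} (I : ℕ) (x : Fin N → ℝ) :
    ∑ j, tail I x j ^ 2 = ∑ j ∈ tailSet N I, x j ^ 2 := by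
  unfold tail tailSet
  rw [Finset.sum_filter]
  refine Finset.sum_congr rfl fun j _ => ?_
  rw [ite_not]
  split_ifs <;> simp

lemma rate_eq {N : ℕ} (cI t : ℝ) (ht1 : 1 ≤ t) (ht2 : t ≤ 2) (n : ℕ) {x : Fin N → ℝ}
    (hx : ∀ j, 0 ≤ x j) :
    rate cI t n x =
      √((∑ j ∈ headSet N (cutoff cI n x), x j ^ (2 * t / (4 - t))) ^ (1 / (2 * t / (4 - t))) / n) +
      (∑ j ∈ tailSet N (cutoff cI n x), x j) ^ ((2 - t) / t) / (n : ℝ) ^ ((2 * t - 2) / t) +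
      1 / n := by
  have hr : 2 * t / (4 - t) ≠ 0 := (div_pos (by linarith) (by linarith)).ne'
  rw [rate, lpNorm_head hr _ hx, lpNorm_one_tail _ hx]

lemma sum_tailSet_cutoff_le {N : ℕ} {cI : ℝ} (hc : 0 ≤ cI) (n : ℕ) (x : Fin N → ℝ) :
    ∑ j ∈ tailSet N (cutoff cI n x), x j ^ 2 ≤ cI / (n : ℝ) ^ 2 := by
  rw [← sum_tail_sq]
  refine Nat.sInf_mem (s := {J : ℕ | ∑ j, tail J x j ^ 2 ≤ cI / (n : ℝ) ^ 2}) ⟨N, ?_⟩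
  simp only [Set.mem_ofPred_eq, tail, Fin.is_lt, if_true]
  simp only [ne_eq, OfNat.ofNat_ne_zero, not_false_eq_true, zero_pow, Finset.sum_const_zero]
  positivity

/-- Minimality of the cutoff, tested at its predecessor. Indices start at 0, so `k` is the last head
coordinate. -/
lemma exists_last_head {N : ℕ} {cI : ℝ} (hc : 0 ≤ cI) (n : ℕ) (x : Fin N → ℝ)
    (hI : 0 < cutoff cI n x) :
    ∃ k : Fin N, (k : ℕ) + 1 = cutoff cI n x ∧
      cI / (n : ℝ) ^ 2 < x k ^ 2 + ∑ j ∈ tailSet N (cutoff cI n x), x j ^ 2 := by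
  have hnot : cutoff cI n x - 1 ∉ {J : ℕ | ∑ j, tail J x j ^ 2 ≤ cI / (n : ℝ) ^ 2} :=
    Nat.notMem_of_lt_sInf (show cutoff cI n x - 1 < cutoff cI n x by omega)
  simp only [Set.mem_ofPred_eq, not_le, sum_tail_sq] at hnot
  have hN : cutoff cI n x - 1 < N := by
    by_contra hN
    have : tailSet N (cutoff cI n x - 1) = ∅ := by
      ext j; simp; omega
    rw [this, Finset.sum_empty] at hnot
    have : 0 ≤ cI / (n : ℝ) ^ 2 := by positivity
    linarith
  refine ⟨⟨cutoff cI n x - 1, hN⟩, by simp; omega, ?_⟩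
  have : tailSet N (cutoff cI n x - 1) =
      insert ⟨cutoff cI n x - 1, hN⟩ (tailSet N (cutoff cI n x)) := by
    ext j; simp [Fin.ext_iff]; omega
  rwa [this, Finset.sum_insert (by simp; omega)] at hnot

lemma last_head_pos {N : ℕ} {cI : ℝ} (hc : 0 ≤ cI) {n : ℕ} {x : Fin N → ℝ} (hx : Antitone x)
    (hx0 : ∀ j, 0 ≤ x j) {k : Fin N} (hk : (k : ℕ) + 1 = cutoff cI n x)
    (h : cI / (n : ℝ) ^ 2 < x k ^ 2 + ∑ j ∈ tailSet N (cutoff cI n x), x j ^ 2) : 0 < x k := by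
  refine (hx0 k).lt_of_ne' fun h0 => ?_
  have : ∑ j ∈ tailSet N (cutoff cI n x), x j ^ 2 = 0 := by
    refine Finset.sum_eq_zero fun j hj => ?_
    have := hx (show k ≤ j by rw [mem_tailSet] at hj; rw [Fin.le_def]; omega)
    rw [le_antisymm (this.trans h0.le) (hx0 j)]; simp
  rw [h0, this] at h
  have : 0 ≤ cI / (n : ℝ) ^ 2 := by positivity
  norm_num at h
  linarith

/-- In `h`, `x k ^ 2 = x k ^ r * x k ^ (2 - r)` is bounded through one term of the head sum, and
every tail entry is at most `x k`; one of the two parts carries half. Both the lower and the upper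
bound rest on this dichotomy. -/
lemma le_head_or_le_tail {N : ℕ} {cI r : ℝ} (hc : 0 ≤ cI) {n : ℕ} (hn : 0 < n) {x : Fin N → ℝ}
    (hx : Antitone x) (hx0 : ∀ j, 0 ≤ x j) {k : Fin N} (hk : (k : ℕ) + 1 = cutoff cI n x)
    (h : cI / (n : ℝ) ^ 2 < x k ^ 2 + ∑ j ∈ tailSet N (cutoff cI n x), x j ^ 2) :
    cI / 2 ≤ (n : ℝ) ^ 2 * (∑ j ∈ headSet N (cutoff cI n x), x j ^ r) * x k ^ (2 - r) ∨
      cI / 2 ≤ (n : ℝ) ^ 2 * (∑ j ∈ tailSet N (cutoff cI n x), x j) * x k := by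
  have hxk := last_head_pos hc hx hx0 hk h
  have hn2 : (0 : ℝ) < (n : ℝ) ^ 2 := by positivity
  rw [div_lt_iff₀ hn2] at h
  have h1 : x k ^ 2 ≤ (∑ j ∈ headSet N (cutoff cI n x), x j ^ r) * x k ^ (2 - r) := by
    have e : x k ^ 2 = x k ^ r * x k ^ (2 - r) := by
      rw [← Real.rpow_add hxk, ← Real.rpow_natCast]; norm_num
    rw [e]
    refine mul_le_mul_of_nonneg_right ?_ (Real.rpow_nonneg hxk.le _)
    exact Finset.single_le_sum (f := fun j => x j ^ r) (fun j _ => Real.rpow_nonneg (hx0 j) _)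
      (by rw [mem_headSet]; omega)
  have h2 : ∑ j ∈ tailSet N (cutoff cI n x), x j ^ 2 ≤
      (∑ j ∈ tailSet N (cutoff cI n x), x j) * x k := by
    rw [Finset.sum_mul]
    refine Finset.sum_le_sum fun j hj => ?_
    have := hx (show k ≤ j by rw [mem_tailSet] at hj; rw [Fin.le_def]; omega)
    rw [sq]
    exact mul_le_mul_of_nonneg_left this (hx0 j)
  by_contra hcon
  rw [not_or, not_le, not_le] at hcon
  have := mul_le_mul_of_nonneg_left (add_le_add h1 h2) hn2.le
  nlinarith [hcon.1, hcon.2]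

/-! ### Hölder's and Chebyshev's inequalities -/

/-- Hölder's inequality; the exponents `a = 0` and `b = 0`, needed at `t = 1` and `t = 2`, have no
finite conjugate pair and are treated apart. -/
lemma sum_rpow_mul_rpow_le {ι : Type*} (s : Finset ι) (x y : ι → ℝ) (hx : ∀ i ∈ s, 0 ≤ x i)
    (hy : ∀ i ∈ s, 0 ≤ y i) {a b : ℝ} (ha : 0 ≤ a) (hb : 0 ≤ b) (hab : a + b = 1) :
    ∑ i ∈ s, x i ^ a * y i ^ b ≤ (∑ i ∈ s, x i) ^ a * (∑ i ∈ s, y i) ^ b := by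
  rcases ha.eq_or_lt with rfl | ha
  · obtain rfl : b = 1 := by linarith
    simp
  rcases hb.eq_or_lt with rfl | hb
  · obtain rfl : a = 1 := by linarith
    simp
  have hpq : (1 / a).HolderConjugate (1 / b) := by
    rw [Real.holderConjugate_iff]
    refine ⟨by rw [lt_div_iff₀ ha]; linarith, by simpa using hab⟩
  have := Real.inner_le_Lp_mul_Lq_of_nonneg s hpq
    (fun i hi => Real.rpow_nonneg (hx i hi) a) (fun i hi => Real.rpow_nonneg (hy i hi) b)
  refine this.trans_eq ?_
  simp only [one_div_one_div]
  congr 2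
  · refine Finset.sum_congr rfl fun i hi => ?_
    rw [← Real.rpow_mul (hx i hi), mul_one_div_cancel ha.ne', Real.rpow_one]
  · refine Finset.sum_congr rfl fun i hi => ?_
    rw [← Real.rpow_mul (hy i hi), mul_one_div_cancel hb.ne', Real.rpow_one]

/-- Chebyshev's inequality for a sum of functions of independent coordinates. -/
lemma pi_real_deviation_le {ι : Type*} [Fintype ι] {α : ι → Type*} [∀ i, Fintype (α i)]
    [∀ i, MeasurableSpace (α i)] [∀ i, MeasurableSingletonClass (α i)]
    (μ : ∀ i, Measure (α i)) [∀ i, IsProbabilityMeasure (μ i)] (X : ∀ i, α i → ℝ) {c : ℝ}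
    (hc : 0 < c) :
    (Measure.pi μ).real {ω | c ≤ |∑ i, X i (ω i) - ∑ i, ∫ y, X i y ∂μ i|} ≤
      (∑ i, Var[X i; μ i]) / c ^ 2 := by
  have hL : ∀ i, MemLp (X i) 2 (μ i) := fun i => MemLp.of_discrete
  have hm : ∫ ω, (∑ i, fun ω : ∀ i, α i => X i (ω i)) ω ∂Measure.pi μ =
      ∑ i, ∫ y, X i y ∂μ i := by
    simp only [Finset.sum_apply]
    rw [integral_finsetSum _ fun i _ => Integrable.of_finite]
    refine Finset.sum_congr rfl fun i _ => ?_
    exact integral_comp_eval (μ := μ) (i := i) (f := X i) (measurable_of_finite _).aestronglyMeasurable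
  have hS : MemLp (∑ i, fun ω : ∀ i, α i => X i (ω i)) 2 (Measure.pi μ) := MemLp.of_discrete
  have := meas_ge_le_variance_div_sq hS hc
  rw [hm, variance_sum_pi hL] at this
  refine ENNReal.toReal_le_of_le_ofReal (div_nonneg (Finset.sum_nonneg fun i _ =>
    variance_nonneg _ _) (sq_nonneg _)) ?_
  simpa only [Finset.sum_apply] using this

lemma integral_bernoulli (q : unitInterval) (g : Bool → ℝ) :
    ∫ b, g b ∂bernoulliMeasure true false q = q * g true + (1 - q) * g false := by
  rw [integral_fintype Integrable.of_finite]
  simp [bernoulli_real_singleton, bitWeight]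

/-- With high probability, the number of ones at the places in `G` is at least half its mean. -/
lemma sum_bitWeight_few_ones_le {N : ℕ} (θ : Fin N → unitInterval) (G : Finset (Fin N))
    (hM : 0 < ∑ j ∈ G, (θ j : ℝ)) :
    ∑ ω : Fin N → Bool,
      (if (∑ j ∈ G, (θ j : ℝ)) / 2 ≤ ∑ j ∈ G, (if ω j then (1 : ℝ) else 0) then 0
        else ∏ j, bitWeight (θ j) (ω j)) ≤ 4 / ∑ j ∈ G, (θ j : ℝ) := by
  classical
  set M := ∑ j ∈ G, (θ j : ℝ) with hMdef
  let μ : Fin N → Measure Bool := fun j => bernoulliMeasure true false (θ j)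
  let X : Fin N → Bool → ℝ := fun j b => if j ∈ G then (if b then 1 else 0) else 0
  have hX : ∀ ω : Fin N → Bool, ∑ j, X j (ω j) = ∑ j ∈ G, if ω j then (1 : ℝ) else 0 := fun ω => by
    simp [X, Finset.sum_ite_mem]
  have hE : ∀ j, ∫ b, X j b ∂μ j = if j ∈ G then (θ j : ℝ) else 0 := fun j => by
    rw [integral_bernoulli]; simp [X]
  have hE' : ∑ j, ∫ b, X j b ∂μ j = M := by simp_rw [hE]; simp [hMdef, Finset.sum_ite_mem]
  -- An indicator equals its square, so its variance is at most its mean.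
  have hV : ∑ j, Var[X j; μ j] ≤ M := by
    rw [← hE']
    refine Finset.sum_le_sum fun j _ => ?_
    refine (variance_le_expectation_sq (measurable_of_finite _).aestronglyMeasurable).trans_eq ?_
    refine integral_congr_ae (Filter.Eventually.of_forall fun b => ?_)
    simp only [X, Pi.pow_apply]
    split_ifs <;> simp
  have h := pi_real_deviation_le μ X (half_pos hM)
  simp only [hX, hE'] at h
  calc _ = ∑ ω : Fin N → Bool, (if ω ∈ {ω : Fin N → Bool |
          ¬ M / 2 ≤ ∑ j ∈ G, (if ω j then (1 : ℝ) else 0)} then (Measure.pi μ).real {ω} else 0) := by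
        refine Finset.sum_congr rfl fun ω _ => ?_
        simp only [Set.mem_ofPred_eq, ite_not, pi_real_singleton, μ, bernoulli_real_singleton]
    _ = (Measure.pi μ).real {ω | ¬ M / 2 ≤ ∑ j ∈ G, (if ω j then (1 : ℝ) else 0)} :=
        (real_eq_sum_singleton _ _).symm
    _ ≤ (Measure.pi μ).real {ω | M / 2 ≤ |∑ j ∈ G, (if ω j then (1 : ℝ) else 0) - M|} := by
        refine measureReal_mono fun ω hω => ?_
        simp only [Set.mem_ofPred_eq, not_le] at hω ⊢
        rw [le_abs]; right; linarith
    _ ≤ M / (M / 2) ^ 2 := h.trans (by gcongr)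
    _ = 4 / M := by field_simp; norm_num

/-! ### Lower bound: the three priors -/

lemma le_paramDist {N : ℕ} {t ρ : ℝ} (ht : 0 < t) (hρ : 0 ≤ ρ) (p q : Fin N → unitInterval)
    (s : Finset (Fin N)) (h : ρ ^ t ≤ ∑ j ∈ s, |(p j : ℝ) - q j| ^ t) : ρ ≤ paramDist t p q := by
  unfold paramDist lpNorm
  have h0 : ∀ j, 0 ≤ |(p j : ℝ) - q j| ^ t := fun j => Real.rpow_nonneg (abs_nonneg _) _
  calc ρ = (ρ ^ t) ^ (1 / t) := by rw [← Real.rpow_mul hρ, mul_one_div_cancel ht.ne', Real.rpow_one]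
    _ ≤ _ := Real.rpow_le_rpow (Real.rpow_nonneg hρ _) (h.trans (Finset.sum_le_sum_of_subset_of_nonneg
        (Finset.subset_univ s) fun j _ _ => h0 j)) (by positivity)

/-- One coordinate is moved up by `γ / n`, at affinity cost `γ`. There is room for it because the
flipped null is at most 1/2. The two branches of the prior coincide, so its weights are immaterial.
-/
lemma le_minimaxRisk_single {n N : ℕ} (hn : 2 ≤ n) (hN : 2 ≤ N) {t ρ γ : ℝ} (ht : 0 < t)
    (hγ0 : 0 < γ) (hγ1 : γ ≤ 1) (hρ : ρ ≤ γ / n) (p : Fin N → unitInterval)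
    (σ : Equiv.Perm (Fin N)) : 1 - γ ≤ minimaxRisk n t ρ p := by
  set f := flipPattern p σ
  set p' := paramEquiv σ f p with hp'
  have hp'h : ∀ j, (p' j : ℝ) ≤ 1 / 2 := fun j => by
    rw [hp', coe_paramEquiv_flipPattern]; exact reduced_le_half p σ j
  have hn' : (2 : ℝ) ≤ n := by exact_mod_cast hn
  have hn0 : (0 : ℝ) < n := by linarith
  have hγn : γ / n ≤ 1 / 2 := by rw [div_le_div_iff₀ hn0 two_pos]; linarith
  have hγn0 : 0 < γ / n := by positivity
  let i : Fin N := ⟨0, by omega⟩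
  let b : Fin N → unitInterval := fun j => if j = i then
    ⟨p' i + γ / n, by linarith [(p' i).2.1], by linarith [hp'h i]⟩ else p' j
  have := le_minimaxRisk_of_choice (n := n) t ρ 0 (∑ j, if j = i then γ else 0) p σ f (fun _ => 1)
    b b (fun _ => True) (fun ω _ => ?_) (by simp) ?_
  · simpa using this
  · refine hρ.trans (le_paramDist ht hγn0.le _ _ {i} ?_)
    rw [Finset.sum_singleton, abs_sub_comm]
    have : choice b b ω i = b i := by simp [choice]
    rw [this]
    simp only [b, if_true]
    rw [show (p' i : ℝ) + γ / n - p' i = γ / n by ring, abs_of_pos hγn0]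
  · refine le_sum_min_of_column _ _ _ _ _ fun j => ?_
    simp only [mixWeight_self]
    split_ifs with h
    · subst h
      have h1 := sum_min_colWeight_of_le (n := n) (p := p' i) (q := p' i + γ / n) (p' i).2.1
        (by linarith) (by linarith [hp'h i])
      rw [show (n : ℝ) * (p' i + γ / n - p' i) = γ by field_simp; ring] at h1
      simpa [b] using h1
    · simp only [b, h, if_false]
      simp [sum_colWeight, ← hp']

/-- With `π = 4c / (n² T)`, the right side counts `T / (4π)` raised coordinates, each contributing
`(π / 2) ^ t`; this fixes the constant of the tail rate. -/
lemma sparse_distance {t T n c : ℝ} (ht : 0 < t) (hT : 0 < T) (hn : 0 < n) (hc : 0 < c) :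
    (((4 * c) ^ (t - 1) / 2 ^ (t + 2)) ^ (1 / t) * (T ^ ((2 - t) / t) / n ^ ((2 * t - 2) / t))) ^ t =
      T / (4 * (4 * c / (n ^ 2 * T))) * (4 * c / (n ^ 2 * T) / 2) ^ t := by
  have h4 : (4 : ℝ) = 2 ^ 2 := by norm_num
  rw [h4]
  obtain ⟨τ, rfl⟩ := exists_eq_exp hT
  obtain ⟨ν, rfl⟩ := exists_eq_exp hn
  obtain ⟨γ, rfl⟩ := exists_eq_exp hc
  obtain ⟨l, hl⟩ := exists_eq_exp (zero_lt_two (α := ℝ))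
  have e : (2 : ℝ) ^ (t + 2) = Real.exp (l * (t + 2)) := by rw [Real.exp_mul, ← hl]
  have e' : ∀ x : ℝ, x / 2 = x / Real.exp l := fun x => by rw [← hl]
  rw [e, e' (_ / _), show ((2 : ℝ) ^ 2) = Real.exp (2 * l) by rw [← exp_sq, ← hl]]
  simp only [exp_sq, ← Real.exp_mul, ← Real.exp_add, ← Real.exp_sub]
  congr 1
  field_simp
  ring

lemma le_minimaxRisk_sparse {n N : ℕ} (hn : 2 ≤ n) {cI t ρ : ℝ} (hc : 0 < cI)
    (hc1 : cI ≤ 1 / 4) (ht : 0 < t) (p : Fin N → unitInterval) (σ : Equiv.Perm (Fin N)) (I : ℕ)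
    (hI : ∑ j ∈ tailSet N I, reduced p σ j ^ 2 ≤ cI / (n : ℝ) ^ 2)
    (hT : 1 / (n : ℝ) ≤ ∑ j ∈ tailSet N I, reduced p σ j)
    (hρ : ρ ≤ ((4 * cI) ^ (t - 1) / 2 ^ (t + 2)) ^ (1 / t) *
      ((∑ j ∈ tailSet N I, reduced p σ j) ^ ((2 - t) / t) / (n : ℝ) ^ ((2 * t - 2) / t))) :
    1 - 36 * cI ≤ minimaxRisk n t ρ p := by
  classical
  set f := flipPattern p σ
  set p' := paramEquiv σ f p with hp'
  have hp'x : ∀ j, (p' j : ℝ) = reduced p σ j := coe_paramEquiv_flipPattern p σ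
  simp only [← hp'x] at hI hT hρ
  set T := ∑ j ∈ tailSet N I, (p' j : ℝ) with hTdef
  have hn' : (2 : ℝ) ≤ n := by exact_mod_cast hn
  have hn0 : (0 : ℝ) < n := by linarith
  have hT0 : 0 < T := lt_of_lt_of_le (by positivity) hT
  have hnT : 1 ≤ n * T := by rwa [div_le_iff₀ hn0, mul_comm] at hT
  -- Chosen so that the total affinity loss `n² T π` equals `4 cI`.
  set π := 4 * cI / ((n : ℝ) ^ 2 * T) with hπ
  have hπ0 : 0 < π := by positivity
  have hπ1 : π ≤ 1 := by
    rw [hπ, div_le_one (by positivity)]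
    nlinarith
  have hπT : (n : ℝ) ^ 2 * (T * π) = 4 * cI := by rw [hπ]; field_simp
  -- Raising such a coordinate to `π` moves it by at least `π / 2`. Since the squares in the tail
  -- sum to at most `cI / n²`, the excluded coordinates carry at most half of `T`.
  let G := (tailSet N I).filter fun j => (p' j : ℝ) ≤ π / 2
  have hG : T / 2 ≤ ∑ j ∈ G, (p' j : ℝ) := by
    have h1 : ∑ j ∈ (tailSet N I).filter (fun j => ¬ (p' j : ℝ) ≤ π / 2), (p' j : ℝ) ≤ T / 2 := by
      calc _ ≤ ∑ j ∈ (tailSet N I).filter (fun j => ¬ (p' j : ℝ) ≤ π / 2),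
            2 / π * (p' j : ℝ) ^ 2 := by
            refine Finset.sum_le_sum fun j hj => ?_
            have := (Finset.mem_filter.1 hj).2
            rw [div_mul_eq_mul_div, le_div_iff₀ hπ0]
            nlinarith [(p' j).2.1]
        _ ≤ ∑ j ∈ tailSet N I, 2 / π * (p' j : ℝ) ^ 2 :=
            Finset.sum_le_sum_of_subset_of_nonneg (Finset.filter_subset _ _)
              fun j _ _ => by positivity
        _ ≤ 2 / π * (cI / (n : ℝ) ^ 2) := by
            rw [← Finset.mul_sum]; gcongr
        _ = T / 2 := by rw [hπ]; field_simp; norm_num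
    have := Finset.sum_filter_add_sum_filter_not (tailSet N I) (fun j => (p' j : ℝ) ≤ π / 2)
      fun j => (p' j : ℝ)
    simp only [G]
    linarith
  let θ : Fin N → unitInterval := fun j => if h : j ∈ G then
    ⟨p' j / π, div_nonneg (p' j).2.1 hπ0.le,
      (div_le_one hπ0).2 (by linarith [(Finset.mem_filter.1 h).2])⟩ else 0
  let a : Fin N → unitInterval := fun j => if j ∈ G then 0 else p' j
  let b : Fin N → unitInterval := fun j => if j ∈ G then ⟨π, hπ0.le, hπ1⟩ else p' j
  have hθ : ∀ j ∈ G, (θ j : ℝ) = p' j / π := fun j hj => by simp [θ, hj]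
  have hM : ∑ j ∈ G, (θ j : ℝ) = (∑ j ∈ G, (p' j : ℝ)) / π := by
    rw [Finset.sum_congr rfl hθ, Finset.sum_div]
  have hM1 : T / (2 * π) ≤ ∑ j ∈ G, (θ j : ℝ) := by
    rw [hM, ← div_div]; gcongr
  have hM0 : 0 < ∑ j ∈ G, (θ j : ℝ) := lt_of_lt_of_le (by positivity) hM1
  -- As `n T ≥ 1`, at least `1 / (8 cI)` coordinates are raised on average; Chebyshev then bounds
  -- the bad part of the prior by `32 cI`.
  have hM2 : 1 / (8 * cI) ≤ ∑ j ∈ G, (θ j : ℝ) := by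
    refine le_trans ?_ hM1
    rw [div_le_div_iff₀ (by positivity) (by positivity)]
    have : π * (n ^ 2 * T) = 4 * cI := by linarith
    have h2 : 1 ≤ (n * T) ^ 2 := one_le_pow₀ hnT
    have h3 : π ≤ 4 * cI * T := by
      rw [← this]
      calc π = π * 1 := (mul_one _).symm
        _ ≤ π * (n * T) ^ 2 := by gcongr
        _ = _ := by ring
    linarith
  have := le_minimaxRisk_of_choice (n := n) t ρ (32 * cI)
    (∑ j, if j ∈ G then (n : ℝ) ^ 2 * (p' j * π) else 0) p σ f θ a b
    (fun ω => (∑ j ∈ G, (θ j : ℝ)) / 2 ≤ ∑ j ∈ G, if ω j then (1 : ℝ) else 0)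
    (fun ω hω => ?_) ?_ ?_
  · refine le_trans ?_ this
    rw [Finset.sum_ite_mem, Finset.univ_inter, ← Finset.mul_sum, ← Finset.sum_mul]
    have : (n : ℝ) ^ 2 * ((∑ j ∈ G, (p' j : ℝ)) * π) ≤ n ^ 2 * (T * π) := by
      gcongr
      exact Finset.sum_le_sum_of_subset_of_nonneg (Finset.filter_subset _ _)
        fun j _ _ => (p' j).2.1
    linarith
  · refine hρ.trans (le_paramDist ht (by positivity) _ _ G ?_)
    rw [sparse_distance ht hT0 hn0 hc, ← hπ]
    calc T / (4 * π) * (π / 2) ^ t ≤ (∑ j ∈ G, if ω j then (1 : ℝ) else 0) * (π / 2) ^ t := by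
          gcongr
          refine le_trans ?_ hω
          rw [show T / (4 * π) = T / (2 * π) / 2 by field_simp; norm_num]
          linarith
      _ ≤ _ := by
          rw [Finset.sum_mul]
          refine Finset.sum_le_sum fun j hj => ?_
          split_ifs with h
          · rw [one_mul]
            refine Real.rpow_le_rpow (by positivity) ?_ ht.le
            have h1 : (choice a b ω j : ℝ) = π := by simp [choice, h, b, hj]
            rw [h1, le_abs]
            right
            linarith [(Finset.mem_filter.1 hj).2]
          · rw [zero_mul]; positivity
  · refine (sum_bitWeight_few_ones_le θ G hM0).trans ?_
    rw [div_le_iff₀ hM0]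
    rw [div_le_iff₀ (by positivity)] at hM2
    linarith
  · refine le_sum_min_of_column _ _ _ _ _ fun j => ?_
    by_cases hj : j ∈ G
    · have h1 := sum_min_sparse (n := n) (p' j).2.1
        (show (p' j : ℝ) ≤ π by linarith [(Finset.mem_filter.1 hj).2]) hπ0 hπ1
      rw [if_pos hj, hθ j hj]
      simpa [a, b, hj] using h1
    · rw [if_neg hj]
      simp only [a, b, hj, if_false]
      rw [sum_min_mixWeight_self]; simp

lemma sqrt_exp_sub_one_le {κ : ℝ} (hκ : κ ^ 4 ≤ 1 / 4) :
    √(Real.exp (2 * κ ^ 4) - 1) / 2 ≤ κ ^ 2 := by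
  have h0 : 0 ≤ κ ^ 4 := by positivity
  have h1 : Real.exp (2 * κ ^ 4) ≤ 1 + 4 * κ ^ 4 := by
    have h2 := Real.add_one_le_exp (-(2 * κ ^ 4))
    have h3 : Real.exp (2 * κ ^ 4) * Real.exp (-(2 * κ ^ 4)) = 1 := by
      rw [← Real.exp_add]; simp
    have h4 := Real.exp_pos (2 * κ ^ 4)
    nlinarith
  have : √(Real.exp (2 * κ ^ 4) - 1) ≤ 2 * κ ^ 2 := by
    rw [Real.sqrt_le_left (by positivity)]
    nlinarith
  linarith

lemma dense_distance {t S n κ l : ℝ} (ht1 : 1 ≤ t) (ht2 : t ≤ 2) (hS : 0 < S) (hn : 0 < n)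
    (hκ : 0 < κ) (hl : l = κ / (√n * S ^ ((1 : ℝ) / 4))) :
    (κ * √(S ^ (1 / (2 * t / (4 - t))) / n)) ^ t = l ^ t * S := by
  subst hl
  obtain ⟨s, rfl⟩ := exists_eq_exp hS
  obtain ⟨ν, rfl⟩ := exists_eq_exp hn
  obtain ⟨κ, rfl⟩ := exists_eq_exp hκ
  simp only [sqrt_exp, ← Real.exp_mul, ← Real.exp_add, ← Real.exp_sub]
  congr 1
  have h4 : 4 - t ≠ 0 := by linarith
  have ht : t ≠ 0 := by linarith
  field_simp
  ring

lemma rpow_pow_four {x : ℝ} (hx : 0 ≤ x) (a : ℝ) : (x ^ a) ^ 4 = x ^ (4 * a) := by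
  rw [← Real.rpow_natCast, ← Real.rpow_mul hx]; congr 1; push_cast; ring

/-- The amplitude `p ^ (2 / (4 - t))` makes both the cost `γ⁴ / p²` and the gain `γ ^ t`
proportional to `p ^ r`; this is the origin of `r`. -/
lemma le_minimaxRisk_dense {n N : ℕ} (hn : 0 < n) {c t ρ κ : ℝ} (ht1 : 1 ≤ t) (ht2 : t ≤ 2)
    (hκ0 : 0 < κ) (hκ1 : κ ^ 4 ≤ 1 / 4) (hκc : κ ^ 4 ≤ c) (p : Fin N → unitInterval)
    (σ : Equiv.Perm (Fin N)) (I : ℕ) {y : ℝ} (hy : 0 < y)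
    (hxy : ∀ j ∈ headSet N I, y ≤ reduced p σ j)
    (hS0 : 0 < ∑ j ∈ headSet N I, reduced p σ j ^ (2 * t / (4 - t)))
    (hS : c ≤ (n : ℝ) ^ 2 * (∑ j ∈ headSet N I, reduced p σ j ^ (2 * t / (4 - t))) *
      y ^ (2 - 2 * t / (4 - t)))
    (hρ : ρ ≤ κ * √((∑ j ∈ headSet N I, reduced p σ j ^ (2 * t / (4 - t))) ^
      (1 / (2 * t / (4 - t))) / n)) :
    1 - κ ^ 2 ≤ minimaxRisk n t ρ p := by
  classical
  set f := flipPattern p σ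
  set p' := paramEquiv σ f p with hp'
  have hp'x : ∀ j, (p' j : ℝ) = reduced p σ j := coe_paramEquiv_flipPattern p σ
  have hp'h : ∀ j, (p' j : ℝ) ≤ 1 / 2 := fun j => by rw [hp'x]; exact reduced_le_half p σ j
  simp only [← hp'x] at hS0 hS hρ hxy
  set r := 2 * t / (4 - t) with hr
  set S := ∑ j ∈ headSet N I, (p' j : ℝ) ^ r with hSdef
  have h4 : 0 < 4 - t := by linarith
  have hn0 : (0 : ℝ) < n := by exact_mod_cast hn
  -- Normalized so that the chi-square exponents add up to `2 n² l⁴ S = 2 κ⁴`.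
  set l := κ / (√n * S ^ ((1 : ℝ) / 4)) with hl
  have hl0 : 0 < l := by positivity
  have hl4 : l ^ 4 = κ ^ 4 / ((n : ℝ) ^ 2 * S) := by
    rw [hl, div_pow, mul_pow, rpow_pow_four hS0.le, show (√(n : ℝ)) ^ 4 = (√(n : ℝ) ^ 2) ^ 2 by ring,
      Real.sq_sqrt hn0.le]
    norm_num
  let γ : Fin N → ℝ := fun j => l * (p' j : ℝ) ^ (2 / (4 - t))
  have hγ0 : ∀ j, 0 ≤ γ j := fun j => mul_nonneg hl0.le (Real.rpow_nonneg (p' j).2.1 _)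
  have hpos : ∀ j ∈ headSet N I, 0 < (p' j : ℝ) := fun j hj => hy.trans_le (hxy j hj)
  have hr2 : 0 ≤ 2 - r := by
    rw [hr, sub_nonneg, div_le_iff₀ h4]; linarith
  have hγ4 : ∀ j ∈ headSet N I, γ j ^ 4 * (p' j : ℝ) ^ (2 - r) = l ^ 4 * (p' j : ℝ) ^ 4 := by
    intro j hj
    simp only [γ]
    rw [mul_pow, rpow_pow_four (hpos j hj).le, mul_assoc, ← Real.rpow_add (hpos j hj),
      show 4 * (2 / (4 - t)) + (2 - r) = (4 : ℕ) by rw [hr]; push_cast; field_simp; ring,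
      Real.rpow_natCast]
  -- The only use of the lower bound `hS`: it keeps `p' j - γ j` nonnegative, even at the smallest
  -- head entries.
  have hγ : ∀ j ∈ headSet N I, γ j ≤ p' j := by
    intro j hj
    refine (pow_le_pow_iff_left₀ (hγ0 j) (hpos j hj).le (n := 4) (by norm_num)).1 ?_
    have h1 : l ^ 4 ≤ (p' j : ℝ) ^ (2 - r) := by
      refine le_trans ?_ (Real.rpow_le_rpow hy.le (hxy j hj) hr2)
      rw [hl4, div_le_iff₀ (by positivity)]
      linarith
    have hpr : 0 < (p' j : ℝ) ^ (2 - r) := Real.rpow_pos_of_pos (hpos j hj) _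
    refine le_of_mul_le_mul_right ?_ hpr
    rw [hγ4 j hj, mul_comm]
    gcongr
  have hγχ : ∀ j ∈ headSet N I, γ j ^ 4 / (p' j : ℝ) ^ 2 = l ^ 4 * (p' j : ℝ) ^ r := by
    intro j hj
    have h0 := hpos j hj
    rw [div_eq_iff (by positivity)]
    have : (p' j : ℝ) ^ (2 - r) * ((p' j : ℝ) ^ r * (p' j : ℝ) ^ 2) = (p' j : ℝ) ^ 4 := by
      rw [← mul_assoc, ← Real.rpow_add h0, sub_add_cancel, Real.rpow_two]; ring
    have hpr : (p' j : ℝ) ^ (2 - r) ≠ 0 := (Real.rpow_pos_of_pos h0 _).ne'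
    refine mul_left_cancel₀ hpr ?_
    rw [mul_comm, hγ4 j hj, ← this]; ring
  let half : unitInterval := ⟨1 / 2, by norm_num, by norm_num⟩
  let a : Fin N → unitInterval := fun j => if h : j ∈ headSet N I then
    ⟨p' j - γ j, by linarith [hγ j h], by linarith [hγ0 j, hp'h j]⟩ else p' j
  let b : Fin N → unitInterval := fun j => if h : j ∈ headSet N I then
    ⟨p' j + γ j, by linarith [hγ0 j, (p' j).2.1], by linarith [hγ j h, hp'h j]⟩ else p' j
  have ha : ∀ j ∈ headSet N I, (a j : ℝ) = p' j - γ j := fun j hj => by simp only [a, hj, dif_pos]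
  have hb : ∀ j ∈ headSet N I, (b j : ℝ) = p' j + γ j := fun j hj => by simp only [b, hj, dif_pos]
  have ha' : ∀ j, j ∉ headSet N I → a j = p' j := fun j hj => by simp only [a, dif_neg hj]
  have hb' : ∀ j, j ∉ headSet N I → b j = p' j := fun j hj => by simp only [b, dif_neg hj]
  have := le_minimaxRisk_of_choice (n := n) t ρ 0 (κ ^ 2) p σ f (fun _ => half) a b
    (fun _ => True) (fun ω _ => ?_) (by simp) ?_
  · simpa using this
  · refine hρ.trans (le_paramDist (by linarith) (by positivity) _ _ (headSet N I) ?_)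
    rw [dense_distance ht1 ht2 hS0 hn0 hκ0 hl, hSdef, Finset.mul_sum]
    refine Finset.sum_le_sum fun j hj => le_of_eq ?_
    have h1 : |(p' j : ℝ) - choice a b ω j| = γ j := by
      unfold choice
      split_ifs
      · rw [hb j hj, sub_add_cancel_left, abs_neg, abs_of_nonneg (hγ0 j)]
      · rw [ha j hj, sub_sub_cancel, abs_of_nonneg (hγ0 j)]
    rw [h1]
    simp only [γ]
    rw [Real.mul_rpow hl0.le (Real.rpow_nonneg (p' j).2.1 _), ← Real.rpow_mul (p' j).2.1]
    congr 2
    rw [hr]; ring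
  · let x : Fin N → ℝ := fun j =>
      if j ∈ headSet N I then 2 * (n : ℝ) ^ 2 * (γ j ^ 4 / (p' j : ℝ) ^ 2) else 0
    have hx : ∑ j, x j = 2 * κ ^ 4 := by
      simp only [x]
      rw [Finset.sum_ite_mem, Finset.univ_inter, ← Finset.mul_sum, Finset.sum_congr rfl hγχ,
        ← Finset.mul_sum, ← hSdef, hl4]
      field_simp
    have := le_sum_min_of_chiSq (n := n) p' (fun _ => half) a b x ?_ ?_
    · rw [hx] at this
      linarith [sqrt_exp_sub_one_le hκ1]
    · intro j y hy
      by_cases hj : j ∈ headSet N I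
      · exfalso
        refine (Finset.prod_pos fun i _ => ?_).ne' hy
        have h0 := hpos j hj
        have h1 := hp'h j
        unfold bitWeight
        split_ifs <;> linarith
      · rw [ha' j hj, hb' j hj, mixWeight_self, hy]
    · intro j
      by_cases hj : j ∈ headSet N I
      · simp only [x, if_pos hj]
        rw [ha j hj, hb j hj]
        exact chiSq_symmetric (hpos j hj) (hp'h j) (hγ0 j) (hγ j hj)
      · simp only [x, if_neg hj, Real.exp_zero]
        rw [ha' j hj, hb' j hj]
        simp only [mixWeight_self]
        have : ∀ y : Fin n → Bool, colWeight (p' j) y ^ 2 / colWeight (p' j) y =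
            colWeight (p' j) y := fun y => by
          rcases eq_or_ne (colWeight (p' j : ℝ) y) 0 with h | h
          · simp [h]
          · field_simp
        simp_rw [this]
        exact (sum_colWeight _).le

/-- The tail term is nondecreasing in `T` and equals `1 / n` at `T = 1 / n`, so the sparse prior is
needed only above that value. -/
lemma tail_rate_le_inv {t T n : ℝ} (ht : 1 ≤ t) (ht2 : t ≤ 2) (hT : 0 ≤ T) (hn : 0 < n)
    (h : T ≤ 1 / n) : T ^ ((2 - t) / t) / n ^ ((2 * t - 2) / t) ≤ 1 / n := by
  have ht0 : 0 < t := by linarith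
  have h1 : T ^ ((2 - t) / t) ≤ (1 / n) ^ ((2 - t) / t) :=
    Real.rpow_le_rpow hT h (div_nonneg (by linarith) ht0.le)
  have h2 : (1 / n) ^ ((2 - t) / t) / n ^ ((2 * t - 2) / t) = 1 / n := by
    rw [one_div, Real.inv_rpow hn.le, ← Real.rpow_neg hn.le, ← Real.rpow_sub hn,
      ← Real.rpow_neg_one]
    congr 1
    field_simp
    ring
  rw [← h2]
  gcongr

/-- The lower bound on the separation radius. -/
lemma rate_le_separationRadius {η : ℝ} (hη₀ : 0 < η) (hη₁ : η < 1) {cI t : ℝ} (hc : 0 < cI)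
    (hc0 : cI ≤ (1 - η) / 72) (ht1 : 1 ≤ t) (ht2 : t ≤ 2) :
    ∃ c : ℝ, 0 < c ∧ ∀ n N : ℕ, 2 ≤ n → 2 ≤ N → ∀ (p : Fin N → unitInterval)
      (σ : Equiv.Perm (Fin N)), Antitone (reduced p σ) →
        c * rate cI t n (reduced p σ) ≤ separationRadius n t η p := by
  set γ := (1 - η) / 2 with hγ
  set β := ((4 * cI) ^ (t - 1) / 2 ^ (t + 2)) ^ (1 / t) with hβ
  set C := (cI / 2) ^ ((3 * t - 4) / (4 * t)) with hC
  have hγ0 : 0 < γ := by rw [hγ]; linarith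
  have hβ0 : 0 < β := by positivity
  have hC0 : 0 < C := by positivity
  have ht0 : 0 < t := by linarith
  -- The constants for the head term, the tail term and `1 / n`, added.
  set K := (1 / cI + C * (1 / β + 1 / γ)) + (1 / β + 1 / γ) + 1 / γ with hK
  have hK0 : 0 < K := by positivity
  refine ⟨1 / K, by positivity, fun n N hn hN p σ hp => ?_⟩
  have hn' : (2 : ℝ) ≤ n := by exact_mod_cast hn
  have hn0 : (0 : ℝ) < n := by linarith
  have hx0 := reduced_nonneg p σ
  set x := reduced p σ with hx
  set I := cutoff cI n x with hI
  set s := separationRadius n t η p with hs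
  have h1 : 1 / (n : ℝ) ≤ 1 / γ * s := by
    have : γ / n ≤ s := le_separationRadius ht0 hη₀ p fun ρ' _ hρ' => by
      have := le_minimaxRisk_single hn hN ht0 hγ0 (by linarith) hρ'.le p σ
      linarith
    rw [one_div_mul_eq_div, le_div_iff₀ hγ0, one_div_mul_eq_div]
    exact this
  have hs0 : 0 ≤ s := by
    have : 0 ≤ 1 / γ * s := le_trans (by positivity) h1
    exact nonneg_of_mul_nonneg_right this (by positivity)
  rw [rate_eq cI t ht1 ht2 n hx0, ← hI]
  set T := ∑ j ∈ tailSet N I, x j with hT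
  set S := ∑ j ∈ headSet N I, x j ^ (2 * t / (4 - t)) with hS
  have hT0 : 0 ≤ T := Finset.sum_nonneg fun j _ => hx0 j
  have h2 : T ^ ((2 - t) / t) / (n : ℝ) ^ ((2 * t - 2) / t) ≤ (1 / β + 1 / γ) * s := by
    rcases le_total T (1 / n) with hTn | hTn
    · refine (tail_rate_le_inv ht1 ht2 hT0 hn0 hTn).trans (h1.trans ?_)
      gcongr
      linarith [show 0 < 1 / β by positivity]
    · have : β * (T ^ ((2 - t) / t) / (n : ℝ) ^ ((2 * t - 2) / t)) ≤ s :=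
        le_separationRadius ht0 hη₀ p fun ρ' _ hρ' => by
          have := le_minimaxRisk_sparse hn hc (by linarith) ht0 p σ I
            (sum_tailSet_cutoff_le hc.le n x) hTn hρ'.le
          linarith
      have h3 : T ^ ((2 - t) / t) / (n : ℝ) ^ ((2 * t - 2) / t) ≤ 1 / β * s := by
        rw [one_div_mul_eq_div, le_div_iff₀ hβ0, mul_comm]; exact this
      refine h3.trans ?_
      gcongr
      linarith [show 0 < 1 / γ by positivity]
  have h3 : √(S ^ (1 / (2 * t / (4 - t))) / n) ≤ (1 / cI + C * (1 / β + 1 / γ)) * s := by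
    have hCs : 0 ≤ C * ((1 / β + 1 / γ) * s) := by positivity
    rcases Nat.eq_zero_or_pos I with hI0 | hI0
    · have : S = 0 := by
        rw [hS, hI0]; refine Finset.sum_eq_zero fun j hj => ?_; simp at hj
      have hr : (0 : ℝ) < 1 / (2 * t / (4 - t)) := by
        have : 0 < 4 - t := by linarith
        positivity
      rw [this, Real.zero_rpow hr.ne', zero_div, Real.sqrt_zero]
      positivity
    · obtain ⟨k, hk, hkI⟩ := exists_last_head hc.le n x hI0
      have hxk := last_head_pos hc.le hp hx0 hk hkI
      have hkS : ∀ j ∈ headSet N I, x k ≤ x j := fun j hj =>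
        hp (by rw [mem_headSet] at hj; rw [Fin.le_def]; omega)
      have hS0 : 0 < S := Finset.sum_pos
        (fun j hj => Real.rpow_pos_of_pos (hxk.trans_le (hkS j hj)) _)
        ⟨k, by rw [mem_headSet]; omega⟩
      -- Either the dense prior applies, with `κ = cI`, or the head term is absorbed by the tail
      -- term.
      rcases le_or_gt (cI / 2) ((n : ℝ) ^ 2 * S * x k ^ (2 - 2 * t / (4 - t))) with hd | hd
      · have hcI1 : cI ≤ 1 / 72 := by linarith
        have hcI2 : cI ^ 2 ≤ cI * (1 / 72) := by rw [sq]; gcongr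
        have hcI4 : cI ^ 4 ≤ cI * (1 / 72) := by
          have : cI ^ 4 = cI ^ 2 * cI ^ 2 := by ring
          have : cI ^ 2 ≤ 1 := by linarith
          nlinarith [sq_nonneg cI]
        have : cI * √(S ^ (1 / (2 * t / (4 - t))) / n) ≤ s :=
          le_separationRadius ht0 hη₀ p fun ρ' _ hρ' => by
            have := le_minimaxRisk_dense (by omega) ht1 ht2 hc (by linarith)
              (show cI ^ 4 ≤ cI / 2 by linarith) p σ I hxk hkS hS0 hd hρ'.le
            linarith
        have h3 : √(S ^ (1 / (2 * t / (4 - t))) / n) ≤ 1 / cI * s := by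
          rw [one_div_mul_eq_div, le_div_iff₀ hc, mul_comm]; exact this
        linarith
      · have hd2 := (le_head_or_le_tail hc.le (by omega : 0 < n) hp hx0 hk hkI).resolve_left
          (not_le.2 hd)
        have hT0 : 0 < T := by
          refine hT0.lt_of_ne' fun h => ?_
          rw [← hI, ← hT, h] at hd2
          linarith
        have h4 := head_rate_le_tail_rate ht1 ht2 hS0 hT0 hxk hn0 (half_pos hc) hd.le hd2
        have h5 := mul_le_mul_of_nonneg_left h2 hC0.le
        have h6 : 0 ≤ 1 / cI * s := by positivity
        linarith
  rw [one_div_mul_eq_div, div_le_iff₀ hK0]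
  rw [hK]
  linarith

/-! ### Moments of centred counts -/

/-- The law of `n` independent `Ber(q)` variables. -/
def bitsLaw (n : ℕ) (q : unitInterval) : Measure (Fin n → Bool) :=
  Measure.pi fun _ => bernoulliMeasure true false q

instance (n : ℕ) (q : unitInterval) : IsProbabilityMeasure (bitsLaw n q) := by
  unfold bitsLaw; infer_instance

/-- The centred number of ones at the places in `G`. -/
def centredCount {n : ℕ} (p : ℝ) (G : Finset (Fin n)) (y : Fin n → Bool) : ℝ :=
  ∑ i ∈ G, ((if y i then 1 else 0) - p)

lemma integral_centredCount {n : ℕ} (p : ℝ) (q : unitInterval) (G : Finset (Fin n)) :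
    ∫ y, centredCount p G y ∂bitsLaw n q = G.card * (q - p) := by
  unfold centredCount
  rw [integral_finsetSum _ fun i _ => Integrable.of_finite]
  have : ∀ i ∈ G, ∫ y : Fin n → Bool, ((if y i then (1 : ℝ) else 0) - p) ∂bitsLaw n q = q - p := by
    intro i _
    refine (integral_comp_eval (μ := fun _ : Fin n => bernoulliMeasure true false q) (i := i)
      (f := fun b : Bool => (if b then (1 : ℝ) else 0) - p)
      (measurable_of_finite _).aestronglyMeasurable).trans ?_
    rw [integral_bernoulli]
    simp only [if_true, Bool.false_eq_true, if_false]
    ring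
  rw [Finset.sum_congr rfl this, Finset.sum_const, nsmul_eq_mul]

lemma variance_centredCount {n : ℕ} (p : ℝ) (q : unitInterval) (G : Finset (Fin n)) :
    Var[centredCount p G; bitsLaw n q] = G.card * (q * (1 - q)) := by
  have h := variance_sum_pi (μ := fun _ : Fin n => bernoulliMeasure true false q)
    (X := fun i b => if i ∈ G then (if b then (1 : ℝ) else 0) - p else 0)
    (fun i => MemLp.of_discrete)
  have e : (∑ i : Fin n, fun y : Fin n → Bool =>
      if i ∈ G then (if y i then (1 : ℝ) else 0) - p else 0) = centredCount p G := by
    ext y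
    simp [centredCount, Finset.sum_apply, Finset.sum_ite_mem]
  rw [e] at h
  have hv : ∀ i, Var[fun b : Bool => if i ∈ G then (if b then (1 : ℝ) else 0) - p else 0;
      bernoulliMeasure true false q] = if i ∈ G then (q * (1 - q) : ℝ) else 0 := by
    intro i
    rw [variance_eq_sub MemLp.of_discrete, integral_bernoulli, integral_bernoulli]
    by_cases hi : i ∈ G
    · simp only [hi, if_true, Pi.pow_apply, Bool.false_eq_true, if_false]
      ring
    · simp [hi]
  simp_rw [hv] at h
  rw [bitsLaw, h, Finset.sum_ite_mem]
  simp

lemma indepFun_centredCount {n : ℕ} (p : ℝ) (q : unitInterval) {G H : Finset (Fin n)}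
    (h : Disjoint G H) : IndepFun (centredCount p G) (centredCount p H) (bitsLaw n q) := by
  have h1 : iIndepFun (fun i (y : Fin n → Bool) => (if y i then (1 : ℝ) else 0) - p)
      (bitsLaw n q) :=
    iIndepFun_pi (μ := fun _ : Fin n => bernoulliMeasure true false q)
      (X := fun _ b => (if b then (1 : ℝ) else 0) - p)
      fun i => (measurable_of_finite _).aemeasurable
  have h2 := (h1.indepFun_finset G H h fun i => measurable_of_finite _).comp
    (φ := fun z : G → ℝ => ∑ i, z i) (ψ := fun z : H → ℝ => ∑ i, z i)
    (by fun_prop) (by fun_prop)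
  convert h2 using 1
  · ext y
    exact (Finset.sum_coe_sort G fun i => (if y i then (1 : ℝ) else 0) - p).symm
  · ext y
    exact (Finset.sum_coe_sort H fun i => (if y i then (1 : ℝ) else 0) - p).symm

/-- Disjoint groups are independent, so the product estimates the squared deviation without a bias
from the variance. -/
lemma integral_centredCount_mul {n m : ℕ} (p : ℝ) (q : unitInterval) {G H : Finset (Fin n)}
    (h : Disjoint G H) (hG : G.card = m) (hH : H.card = m) :
    ∫ y, centredCount p G y * centredCount p H y ∂bitsLaw n q = (m : ℝ) ^ 2 * (q - p) ^ 2 := by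
  rw [(indepFun_centredCount p q h).integral_fun_mul_eq_mul_integral
    (measurable_of_finite _).aestronglyMeasurable (measurable_of_finite _).aestronglyMeasurable,
    integral_centredCount, integral_centredCount, hG, hH]
  ring

lemma variance_centredCount_mul {n m : ℕ} (p : ℝ) (q : unitInterval) {G H : Finset (Fin n)}
    (h : Disjoint G H) (hG : G.card = m) (hH : H.card = m) :
    Var[fun y => centredCount p G y * centredCount p H y; bitsLaw n q] =
      (m : ℝ) ^ 2 * (q * (1 - q)) ^ 2 + 2 * (m : ℝ) ^ 3 * (q * (1 - q)) * (q - p) ^ 2 := by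
  have hsq : ∀ K : Finset (Fin n), K.card = m → ∫ y, centredCount p K y ^ 2 ∂bitsLaw n q =
      m * (q * (1 - q)) + (m * (q - p)) ^ 2 := by
    intro K hK
    have h1 := variance_eq_sub (μ := bitsLaw n q) (X := centredCount p K) MemLp.of_discrete
    rw [variance_centredCount, integral_centredCount, hK] at h1
    simp only [Pi.pow_apply] at h1
    linarith
  have h2 : ∫ y, centredCount p G y ^ 2 * centredCount p H y ^ 2 ∂bitsLaw n q =
      (m * (q * (1 - q)) + (m * (q - p)) ^ 2) * (m * (q * (1 - q)) + (m * (q - p)) ^ 2) := by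
    have := ((indepFun_centredCount p q h).comp (φ := fun z : ℝ => z ^ 2)
      (ψ := fun z : ℝ => z ^ 2) (by fun_prop) (by fun_prop)).integral_fun_mul_eq_mul_integral
      (measurable_of_finite _).aestronglyMeasurable (measurable_of_finite _).aestronglyMeasurable
    simp only [Function.comp_def] at this
    rw [this, hsq G hG, hsq H hH]
  rw [variance_eq_sub MemLp.of_discrete, integral_centredCount_mul p q h hG hH]
  simp only [Pi.pow_apply, mul_pow] at h2 ⊢
  rw [h2]
  ring

/-! ### The quadratic and linear tests -/

/-- Bounds the variance under the alternative by a small multiple of the squared mean `(m² D)²`.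
Here `a` is the null scale and `W` the largest weight; the total `8 κ` is made of `2 κ + 2 κ + 4 κ`.
-/
lemma sum_quadratic_variance_le {ι : Type*} [Fintype ι] (w p Δ v : ι → ℝ) {a W D κ m : ℝ}
    (hw : ∀ j, 0 ≤ w j) (hv0 : ∀ j, 0 ≤ v j) (hv : ∀ j, v j ≤ p j + |Δ j|)
    (ha : 0 ≤ a) (hV : ∑ j, w j ^ 2 * p j ^ 2 ≤ a ^ 2) (hD : D = ∑ j, w j * Δ j ^ 2)
    (hW : ∀ j, w j ≤ W) (hm : 0 ≤ m) (hκ0 : 0 ≤ κ) (hκ1 : κ ≤ 1) (h1 : a ≤ κ * m * D)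
    (h2 : W ≤ κ ^ 2 * m ^ 2 * D) :
    ∑ j, w j ^ 2 * (m ^ 2 * v j ^ 2 + 2 * m ^ 3 * v j * Δ j ^ 2) ≤ 8 * κ * m ^ 4 * D ^ 2 := by
  have hD0 : 0 ≤ D := by rw [hD]; exact Finset.sum_nonneg fun j _ => mul_nonneg (hw j) (sq_nonneg _)
  have hκmD : 0 ≤ κ * m * D := by positivity
  have hterm : ∀ j, w j ^ 2 * (m ^ 2 * v j ^ 2 + 2 * m ^ 3 * v j * Δ j ^ 2) ≤
      2 * m ^ 2 * (w j ^ 2 * p j ^ 2) +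
        (2 * m ^ 2 * W + 4 * κ * m ^ 4 * D) * (w j * Δ j ^ 2) := by
    intro j
    have hwΔ : w j * Δ j ^ 2 ≤ D := by
      rw [hD]
      exact Finset.single_le_sum (f := fun j => w j * Δ j ^ 2)
        (fun j _ => mul_nonneg (hw j) (sq_nonneg _)) (Finset.mem_univ j)
    have hwp : w j * p j ≤ a := by
      refine abs_le_of_sq_le_sq' ?_ ha |>.2
      rw [mul_pow]
      exact (Finset.single_le_sum (f := fun j => w j ^ 2 * p j ^ 2)
        (fun j _ => by positivity) (Finset.mem_univ j)).trans hV
    -- A single large deviation is controlled by `D` itself: `w² Δ² = w (w Δ²) ≤ W D`.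
    have hwabs : w j * |Δ j| ≤ κ * m * D := by
      refine abs_le_of_sq_le_sq' ?_ hκmD |>.2
      rw [mul_pow, sq_abs]
      calc w j ^ 2 * Δ j ^ 2 = w j * (w j * Δ j ^ 2) := by ring
        _ ≤ (κ ^ 2 * m ^ 2 * D) * D :=
          mul_le_mul ((hW j).trans h2) hwΔ (mul_nonneg (hw j) (sq_nonneg _)) (by positivity)
        _ = _ := by ring
    have hwv : w j * v j ≤ 2 * (κ * m * D) := by
      have := mul_le_mul_of_nonneg_left (hv j) (hw j)
      linarith
    have hv2 : v j ^ 2 ≤ 2 * p j ^ 2 + 2 * Δ j ^ 2 := by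
      have : v j ^ 2 ≤ (p j + |Δ j|) ^ 2 := pow_le_pow_left₀ (hv0 j) (hv j) 2
      nlinarith [sq_nonneg (p j - |Δ j|), sq_abs (Δ j)]
    have e1 : w j ^ 2 * (m ^ 2 * v j ^ 2) ≤
        2 * m ^ 2 * (w j ^ 2 * p j ^ 2) + 2 * m ^ 2 * W * (w j * Δ j ^ 2) := by
      calc w j ^ 2 * (m ^ 2 * v j ^ 2) ≤ w j ^ 2 * (m ^ 2 * (2 * p j ^ 2 + 2 * Δ j ^ 2)) := by gcongr
        _ = 2 * m ^ 2 * (w j ^ 2 * p j ^ 2) + 2 * m ^ 2 * w j * (w j * Δ j ^ 2) := by ring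
        _ ≤ _ := by
          gcongr
          · exact mul_nonneg (hw j) (sq_nonneg _)
          · exact hW j
    have e2 : w j ^ 2 * (2 * m ^ 3 * v j * Δ j ^ 2) ≤ 4 * κ * m ^ 4 * D * (w j * Δ j ^ 2) := by
      calc w j ^ 2 * (2 * m ^ 3 * v j * Δ j ^ 2)
          = 2 * m ^ 3 * (w j * v j) * (w j * Δ j ^ 2) := by ring
        _ ≤ 2 * m ^ 3 * (2 * (κ * m * D)) * (w j * Δ j ^ 2) := by
          gcongr
          exact mul_nonneg (hw j) (sq_nonneg _)
        _ = _ := by ring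
    calc _ = w j ^ 2 * (m ^ 2 * v j ^ 2) + w j ^ 2 * (2 * m ^ 3 * v j * Δ j ^ 2) := by ring
      _ ≤ _ := by linarith
  refine (Finset.sum_le_sum fun j _ => hterm j).trans ?_
  rw [Finset.sum_add_distrib, ← Finset.mul_sum, ← Finset.mul_sum, ← hD]
  have k1 : a ^ 2 ≤ κ * (m ^ 2 * D ^ 2) := by
    calc a ^ 2 ≤ (κ * m * D) ^ 2 := pow_le_pow_left₀ ha h1 2
      _ = κ * (κ * (m ^ 2 * D ^ 2)) := by ring
      _ ≤ κ * (1 * (m ^ 2 * D ^ 2)) := by gcongr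
      _ = _ := by ring
  have k2 : W * D ≤ κ * (m ^ 2 * D ^ 2) := by
    calc W * D ≤ κ ^ 2 * m ^ 2 * D * D := by gcongr
      _ = κ * (κ * (m ^ 2 * D ^ 2)) := by ring
      _ ≤ κ * (1 * (m ^ 2 * D ^ 2)) := by gcongr
      _ = _ := by ring
  have k3 : 2 * m ^ 2 * ∑ j, w j ^ 2 * p j ^ 2 ≤ 2 * m ^ 2 * (κ * (m ^ 2 * D ^ 2)) := by
    gcongr; exact hV.trans k1
  have k4 : 2 * m ^ 2 * (W * D) ≤ 2 * m ^ 2 * (κ * (m ^ 2 * D ^ 2)) := by gcongr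
  calc _ ≤ 2 * m ^ 2 * (κ * (m ^ 2 * D ^ 2)) + (2 * m ^ 2 * (W * D) + 4 * κ * m ^ 4 * D * D) := by
        linarith
    _ ≤ 2 * m ^ 2 * (κ * (m ^ 2 * D ^ 2)) +
        (2 * m ^ 2 * (κ * (m ^ 2 * D ^ 2)) + 4 * κ * m ^ 4 * D * D) := by gcongr
    _ = _ := by ring

/-- A test based on a weighted sum of products of centred counts over disjoint groups of
observations. -/
lemma exists_quadratic_test {n N : ℕ} (hn : 2 ≤ n) (p : Fin N → unitInterval) (w : Fin N → ℝ)
    (hw : ∀ j, 0 ≤ w j) {a ε : ℝ} (ha : 0 < a) (hV : ∑ j, w j ^ 2 * (p j : ℝ) ^ 2 ≤ a ^ 2)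
    (hε0 : 0 < ε) (hε1 : ε ≤ 1) :
    ∃ R : Set (Fin N → Fin n → Bool), (colLaw n p).real R ≤ ε ∧
      ∀ (q : Fin N → unitInterval) (W : ℝ), (∀ j, w j ≤ W) →
        a ≤ ε / 96 * n * ∑ j, w j * ((q j : ℝ) - p j) ^ 2 →
        W ≤ (ε / 96) ^ 2 * (n : ℝ) ^ 2 * ∑ j, w j * ((q j : ℝ) - p j) ^ 2 →
        (colLaw n q).real Rᶜ ≤ ε := by
  obtain ⟨G, hG⟩ := Finset.exists_subset_card_eq (s := (Finset.univ : Finset (Fin n)))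
    (n := n / 2) (by rw [Finset.card_univ, Fintype.card_fin]; omega)
  obtain ⟨H, hH⟩ := Finset.exists_subset_card_eq (s := Finset.univ \ G) (n := n / 2) (by
    rw [Finset.card_sdiff_of_subset (Finset.subset_univ _), hG.2, Finset.card_univ,
      Fintype.card_fin]; omega)
  have hGH : Disjoint G H := Finset.disjoint_of_subset_right hH.1 Finset.disjoint_sdiff
  set m := n / 2 with hm
  have hm0 : (0 : ℝ) < m := by exact_mod_cast (by omega : 0 < m)
  -- Replacing `m` by `n / 3` turns the constant 32 into 96.
  have hm3 : (n : ℝ) / 3 ≤ m := by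
    rw [div_le_iff₀ (by norm_num)]; exact_mod_cast (by omega : n ≤ m * 3)
  let X : Fin N → (Fin n → Bool) → ℝ := fun j y =>
    w j * (centredCount (p j) G y * centredCount (p j) H y)
  have hE : ∀ (q : Fin N → unitInterval), ∑ j, ∫ y, X j y ∂bitsLaw n (q j) =
      (m : ℝ) ^ 2 * ∑ j, w j * ((q j : ℝ) - p j) ^ 2 := by
    intro q
    rw [Finset.mul_sum]
    refine Finset.sum_congr rfl fun j _ => ?_
    rw [integral_const_mul, integral_centredCount_mul _ _ hGH hG.2 hH.2]
    ring
  have hvar : ∀ (q : Fin N → unitInterval) (j : Fin N), Var[X j; bitsLaw n (q j)] =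
      w j ^ 2 * ((m : ℝ) ^ 2 * (q j * (1 - q j)) ^ 2 +
        2 * (m : ℝ) ^ 3 * (q j * (1 - q j)) * ((q j : ℝ) - p j) ^ 2) := by
    intro q j
    rw [variance_const_mul, variance_centredCount_mul _ _ hGH hG.2 hH.2]
  have hdev : ∀ (q : Fin N → unitInterval) {c : ℝ}, 0 < c →
      (colLaw n q).real {y | c ≤ |∑ j, X j (y j) -
        (m : ℝ) ^ 2 * ∑ j, w j * ((q j : ℝ) - p j) ^ 2|} ≤
      (∑ j, Var[X j; bitsLaw n (q j)]) / c ^ 2 := by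
    intro q c hc
    have := pi_real_deviation_le (fun j => bitsLaw n (q j)) X hc
    rwa [hE] at this
  -- The null standard deviation is at most `m a`, so this threshold has null error at most `ε²`.
  refine ⟨{y | m * a / ε ≤ ∑ j, X j (y j)}, ?_, ?_⟩
  · have hc : 0 < m * a / ε := by positivity
    have h1 := hdev p hc
    simp only [sub_self, ne_eq, OfNat.ofNat_ne_zero, not_false_eq_true, zero_pow, mul_zero,
      Finset.sum_const_zero, sub_zero, hvar, add_zero] at h1
    have h2 : ∑ j, w j ^ 2 * ((m : ℝ) ^ 2 * (p j * (1 - p j)) ^ 2) ≤ (m : ℝ) ^ 2 * a ^ 2 := by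
      refine le_trans ?_ (mul_le_mul_of_nonneg_left hV (sq_nonneg _))
      rw [Finset.mul_sum]
      refine Finset.sum_le_sum fun j _ => ?_
      have : ((p j : ℝ) * (1 - p j)) ^ 2 ≤ (p j : ℝ) ^ 2 := by
        refine pow_le_pow_left₀ (mul_nonneg (p j).2.1 (by linarith [(p j).2.2])) ?_ 2
        nlinarith [(p j).2.1]
      calc w j ^ 2 * ((m : ℝ) ^ 2 * (p j * (1 - p j)) ^ 2)
          ≤ w j ^ 2 * ((m : ℝ) ^ 2 * (p j : ℝ) ^ 2) := by gcongr
        _ = _ := by ring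
    calc _ ≤ (colLaw n p).real {y | m * a / ε ≤ |∑ j, X j (y j)|} :=
          measureReal_mono fun y hy => le_trans (show m * a / ε ≤ _ from hy) (le_abs_self _)
      _ ≤ (m : ℝ) ^ 2 * a ^ 2 / (m * a / ε) ^ 2 := h1.trans (by gcongr)
      _ = ε ^ 2 := by field_simp
      _ ≤ ε := by nlinarith
  · intro q W hW h1 h2
    set D := ∑ j, w j * ((q j : ℝ) - p j) ^ 2 with hD
    have hn0 : (0 : ℝ) < n := by exact_mod_cast (by omega : 0 < n)
    have hD0 : 0 < D := by
      by_contra hneg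
      have : ε / 96 * n * D ≤ 0 := mul_nonpos_of_nonneg_of_nonpos (by positivity) (not_lt.1 hneg)
      linarith
    have h1' : a ≤ ε / 32 * m * D := h1.trans (by
      have : ε / 96 * n * D = ε / 32 * (n / 3) * D := by ring
      rw [this]; gcongr)
    have h2' : W ≤ (ε / 32) ^ 2 * (m : ℝ) ^ 2 * D := h2.trans (by
      have : (ε / 96) ^ 2 * (n : ℝ) ^ 2 * D = (ε / 32) ^ 2 * (n / 3 : ℝ) ^ 2 * D := by ring
      rw [this]; gcongr)
    have hc : 0 < (m : ℝ) ^ 2 * D / 2 := by positivity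
    have h3 := hdev q hc
    simp only [hvar, ← hD] at h3
    -- Chebyshev at half the mean costs a factor 4, so `κ = ε / 32` gives error `32 κ = ε`.
    have h4 := sum_quadratic_variance_le w (fun j => (p j : ℝ)) (fun j => (q j : ℝ) - p j)
      (fun j => q j * (1 - q j)) hw
      (fun j => mul_nonneg (q j).2.1 (by linarith [(q j).2.2]))
      (fun j => by nlinarith [(q j).2.1, le_abs_self ((q j : ℝ) - p j)])
      ha.le hV hD hW hm0.le (by positivity) (by linarith) h1' h2'
    calc _ ≤ (colLaw n q).real {y | (m : ℝ) ^ 2 * D / 2 ≤ |∑ j, X j (y j) - (m : ℝ) ^ 2 * D|} := by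
          refine measureReal_mono fun y hy => ?_
          simp only [Set.mem_compl_iff, Set.mem_ofPred_eq, not_le] at hy ⊢
          have : m * a / ε ≤ (m : ℝ) ^ 2 * D / 2 := by
            rw [div_le_iff₀ hε0]
            have := mul_le_mul_of_nonneg_left h1' hm0.le
            have : 0 < ε * ((m : ℝ) ^ 2 * D) := by positivity
            nlinarith
          rw [le_abs]; right; linarith
      _ ≤ 8 * (ε / 32) * (m : ℝ) ^ 4 * D ^ 2 / ((m : ℝ) ^ 2 * D / 2) ^ 2 := h3.trans (by gcongr)
      _ = ε := by field_simp; norm_num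

/-- A test based on the sum of the centred counts of the coordinates in `G`. -/
lemma exists_linear_test {n N : ℕ} (hn : 0 < n) (p : Fin N → unitInterval) (G : Finset (Fin N))
    {ε : ℝ} (hε0 : 0 < ε) (hε1 : ε ≤ 1) :
    ∃ R : Set (Fin N → Fin n → Bool), (colLaw n p).real R ≤ ε ∧
      ∀ q : Fin N → unitInterval,
        16 / ε * (n * ∑ j ∈ G, (p j : ℝ) + 1) ≤ n * ∑ j ∈ G, ((q j : ℝ) - p j) →
        (colLaw n q).real Rᶜ ≤ ε := by
  have hn0 : (0 : ℝ) < n := by exact_mod_cast hn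
  set T := ∑ j ∈ G, (p j : ℝ) with hT
  have hT0 : 0 ≤ T := Finset.sum_nonneg fun j _ => (p j).2.1
  let w : Fin N → ℝ := fun j => if j ∈ G then 1 else 0
  let X : Fin N → (Fin n → Bool) → ℝ := fun j y => w j * centredCount (p j) Finset.univ y
  have hE : ∀ (q : Fin N → unitInterval), ∑ j, ∫ y, X j y ∂bitsLaw n (q j) =
      n * ∑ j ∈ G, ((q j : ℝ) - p j) := by
    intro q
    have : ∀ j, ∫ y, X j y ∂bitsLaw n (q j) = if j ∈ G then n * ((q j : ℝ) - p j) else 0 := by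
      intro j
      rw [integral_const_mul, integral_centredCount]
      simp [w]
    simp_rw [this]
    rw [Finset.sum_ite_mem, Finset.univ_inter, Finset.mul_sum]
  have hvar : ∀ (q : Fin N → unitInterval), ∑ j, Var[X j; bitsLaw n (q j)] ≤
      n * ∑ j ∈ G, (q j : ℝ) := by
    intro q
    have : ∀ j, Var[X j; bitsLaw n (q j)] = if j ∈ G then n * (q j * (1 - q j) : ℝ) else 0 := by
      intro j
      rw [variance_const_mul, variance_centredCount]
      simp [w]
    simp_rw [this]
    rw [Finset.sum_ite_mem, Finset.univ_inter, Finset.mul_sum]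
    refine Finset.sum_le_sum fun j _ => ?_
    gcongr
    nlinarith [(q j).2.1]
  have hdev : ∀ (q : Fin N → unitInterval) {c : ℝ}, 0 < c →
      (colLaw n q).real {y | c ≤ |∑ j, X j (y j) - n * ∑ j ∈ G, ((q j : ℝ) - p j)|} ≤
      (n * ∑ j ∈ G, (q j : ℝ)) / c ^ 2 := by
    intro q c hc
    have := pi_real_deviation_le (fun j => bitsLaw n (q j)) X hc
    rw [hE] at this
    exact this.trans (by gcongr; exact hvar q)
  have hnT : 0 ≤ n * T := by positivity
  -- The null variance is at most `n T ≤ (n T + 1)²`; the added 1 keeps the threshold positive when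
  -- `T = 0`.
  refine ⟨{y | (n * T + 1) / ε ≤ ∑ j, X j (y j)}, ?_, ?_⟩
  · have hc : 0 < (n * T + 1) / ε := by positivity
    have h1 := hdev p hc
    simp only [sub_self, Finset.sum_const_zero, mul_zero, sub_zero] at h1
    calc _ ≤ (colLaw n p).real {y | (n * T + 1) / ε ≤ |∑ j, X j (y j)|} :=
          measureReal_mono fun y hy => le_trans (show (n * T + 1) / ε ≤ _ from hy) (le_abs_self _)
      _ ≤ n * T / ((n * T + 1) / ε) ^ 2 := h1
      _ = ε ^ 2 * (n * T / (n * T + 1) ^ 2) := by field_simp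
      _ ≤ ε ^ 2 * 1 := by
        gcongr
        rw [div_le_one (by positivity)]
        nlinarith
      _ ≤ ε := by nlinarith
  · intro q h
    set E := ∑ j ∈ G, ((q j : ℝ) - p j) with hEdef
    have hq : ∑ j ∈ G, (q j : ℝ) = E + T := by
      rw [hEdef, hT, ← Finset.sum_add_distrib]; simp
    have h16 : 16 * (n * T + 1) ≤ ε * (n * E) := by
      rwa [div_mul_eq_mul_div, div_le_iff₀ hε0, mul_comm (n * E)] at h
    have hnE : 0 < n * E := by
      have : 0 < ε * (n * E) := by linarith
      exact pos_of_mul_pos_right this hε0.le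
    have h3 := hdev q (half_pos hnE)
    rw [hq] at h3
    calc _ ≤ (colLaw n q).real {y | n * E / 2 ≤ |∑ j, X j (y j) - n * E|} := by
          refine measureReal_mono fun y hy => ?_
          simp only [Set.mem_compl_iff, Set.mem_ofPred_eq, not_le] at hy ⊢
          have : (n * T + 1) / ε ≤ n * E / 2 := by
            rw [div_le_iff₀ hε0]; linarith
          rw [le_abs]; right; linarith
      _ ≤ n * (E + T) / (n * E / 2) ^ 2 := h3
      _ ≤ ε := by
        rw [div_le_iff₀ (by positivity)]
        have : n * T ≤ n * E := by nlinarith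
        nlinarith

/-! ### Upper bound: head and tail tests -/

/-- Hölder turns `ℓ_t` separation into a large weighted signal `D`. `hK1` lets `D` beat the null
scale `√S`; `hK2` and `hK3` let it beat the largest weight in the two cases of `le_head_or_le_tail`.
-/
lemma exists_head_test {n N : ℕ} (hn : 2 ≤ n) {cI t ε K : ℝ} (hc : 0 < cI) (ht1 : 1 ≤ t)
    (ht2 : t ≤ 2) (hε0 : 0 < ε) (hε1 : ε ≤ 1) (hK0 : 0 < K) (hK1 : 1 ≤ ε / 96 * K ^ 2)
    (hK2 : 1 ≤ (ε / 96) ^ 2 * (K ^ 2 * √(cI / 2)))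
    (hK3 : 1 ≤ (ε / 96) ^ 2 * (K ^ 2 * (cI / 2) ^ ((2 - t) / t))) (p : Fin N → unitInterval)
    (hp : Antitone fun j => (p j : ℝ)) :
    ∃ R : Set (Fin N → Fin n → Bool), (colLaw n p).real R ≤ ε ∧ ∀ q : Fin N → unitInterval,
      (K * rate cI t n fun j => (p j : ℝ)) ^ t ≤
        ∑ j ∈ headSet N (cutoff cI n fun j => (p j : ℝ)), |(p j : ℝ) - q j| ^ t →
      (colLaw n q).real Rᶜ ≤ ε := by
  classical
  have hn0 : (0 : ℝ) < n := by exact_mod_cast (by omega : 0 < n)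
  have h4 : 0 < 4 - t := by linarith
  have ht0 : 0 < t := by linarith
  have hp0 : ∀ j, 0 ≤ (p j : ℝ) := fun j => (p j).2.1
  have hrate := rate_eq cI t ht1 ht2 n hp0
  set x : Fin N → ℝ := fun j => (p j : ℝ) with hx
  set I := cutoff cI n x with hI
  set r := 2 * t / (4 - t) with hr
  set S := ∑ j ∈ headSet N I, x j ^ r with hS
  set T := ∑ j ∈ tailSet N I, x j with hT
  have hT0 : 0 ≤ T := Finset.sum_nonneg fun j _ => hp0 j
  have hA0 : 0 ≤ √(S ^ (1 / r) / n) := Real.sqrt_nonneg _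
  have hB0 : 0 ≤ T ^ ((2 - t) / t) / (n : ℝ) ^ ((2 * t - 2) / t) := by positivity
  have hinv : 0 < 1 / (n : ℝ) := by positivity
  have hrate0 : 0 < rate cI t n x := by rw [hrate]; linarith
  rcases Nat.eq_zero_or_pos I with hI0 | hI0
  -- With an empty head the separation hypothesis is impossible, so nothing needs to be rejected.
  · refine ⟨∅, by simpa using hε0.le, fun q hq => ?_⟩
    have : headSet N I = ∅ := by ext j; simp [hI0]
    rw [this, Finset.sum_empty] at hq
    exact absurd hq (not_le.2 (by positivity))
  obtain ⟨k, hk, hkI⟩ := exists_last_head hc.le n x hI0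
  have hxk := last_head_pos hc.le hp hp0 hk hkI
  have hkS : ∀ j ∈ headSet N I, x k ≤ x j := fun j hj =>
    hp (by rw [mem_headSet] at hj; rw [Fin.le_def]; omega)
  have hpos : ∀ j ∈ headSet N I, 0 < x j := fun j hj => hxk.trans_le (hkS j hj)
  have hS0 : 0 < S := Finset.sum_pos (fun j hj => Real.rpow_pos_of_pos (hpos j hj) _)
    ⟨k, by rw [mem_headSet]; omega⟩
  have hr2 : 0 ≤ 2 - r := by
    rw [hr, sub_nonneg, div_le_iff₀ h4]; linarith
  -- With these weights `∑ w² x²` equals `S`, and the powers of `x` cancel in the Hölder step below.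
  let w : Fin N → ℝ := fun j => if j ∈ headSet N I then x j ^ (-((2 - r) / 2)) else 0
  have hw0 : ∀ j, 0 ≤ w j := fun j => by
    simp only [w]; split_ifs
    · exact Real.rpow_nonneg (hp0 j) _
    · exact le_rfl
  have hwV : ∑ j, w j ^ 2 * x j ^ 2 ≤ √S ^ 2 := by
    rw [Real.sq_sqrt hS0.le]
    have : ∀ j, w j ^ 2 * x j ^ 2 = if j ∈ headSet N I then x j ^ r else 0 := fun j => by
      simp only [w]; split_ifs with h
      · rw [← Real.rpow_natCast (x j ^ _) 2, ← Real.rpow_mul (hp0 j), ← Real.rpow_natCast (x j) 2,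
          ← Real.rpow_add (hpos j h)]
        congr 1; push_cast; ring
      · simp
    simp_rw [this]
    rw [Finset.sum_ite_mem, Finset.univ_inter]
  have hwW : ∀ j, w j ≤ x k ^ (-((2 - r) / 2)) := fun j => by
    simp only [w]; split_ifs with h
    · exact Real.rpow_le_rpow_of_nonpos hxk (hkS j h) (by linarith)
    · exact Real.rpow_nonneg hxk.le _
  obtain ⟨R, hR, hRq⟩ := exists_quadratic_test hn p w hw0 (Real.sqrt_pos.2 hS0) hwV hε0 hε1
  refine ⟨R, hR, fun q hq => ?_⟩
  set D := ∑ j, w j * ((q j : ℝ) - p j) ^ 2 with hD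
  have hD' : D = ∑ j ∈ headSet N I, x j ^ (-((2 - r) / 2)) * ((q j : ℝ) - p j) ^ 2 := by
    rw [hD, ← Finset.univ_inter (headSet N I), ← Finset.sum_ite_mem]
    exact Finset.sum_congr rfl fun j _ => by simp only [w]; split_ifs <;> simp
  have hhol : ∑ j ∈ headSet N I, |x j - q j| ^ t ≤ D ^ (t / 2) * S ^ (1 - t / 2) := by
    rw [hD', hS]
    refine le_trans (le_of_eq ?_) (sum_rpow_mul_rpow_le (headSet N I)
      (fun j => x j ^ (-((2 - r) / 2)) * ((q j : ℝ) - p j) ^ 2) (fun j => x j ^ r)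
      (fun j _ => mul_nonneg (Real.rpow_nonneg (hp0 j) _) (sq_nonneg _))
      (fun j _ => Real.rpow_nonneg (hp0 j) _) (by linarith) (by linarith) (by ring))
    refine Finset.sum_congr rfl fun j hj => ?_
    rw [Real.mul_rpow (Real.rpow_nonneg (hp0 j) _) (sq_nonneg _), ← Real.rpow_mul (hp0 j),
      ← Real.rpow_mul (hp0 j), mul_right_comm, ← Real.rpow_add (hpos j hj),
      show -((2 - r) / 2) * (t / 2) + r * (1 - t / 2) = 0 by rw [hr]; field_simp; ring,
      Real.rpow_zero, one_mul, ← sq_abs, ← Real.rpow_natCast, ← Real.rpow_mul (abs_nonneg _),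
      abs_sub_comm]
    congr 1
    push_cast; ring
  have hmain : (K * rate cI t n x) ^ t ≤ D ^ (t / 2) * S ^ (1 - t / 2) := hq.trans hhol
  have hD0 : 0 < D := by
    have hDn : 0 ≤ D := Finset.sum_nonneg fun j _ => mul_nonneg (hw0 j) (sq_nonneg _)
    refine hDn.lt_of_ne' fun h => ?_
    rw [h, Real.zero_rpow (by positivity), zero_mul] at hmain
    exact absurd hmain (not_le.2 (by positivity))
  have hle : ∀ u, 0 ≤ u → u ≤ rate cI t n x → (K * u) ^ t ≤ D ^ (t / 2) * S ^ (1 - t / 2) :=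
    fun u hu0 hu => (Real.rpow_le_rpow (by positivity) (by gcongr) ht0.le).trans hmain
  have hDA : K ^ 2 * (√S / n) ≤ D := sq_mul_sqrt_div_le ht1 ht2 hS0 hn0 hK0 hD0
    (hle _ hA0 (by rw [← hr, hrate]; linarith))
  have hfin : ∀ u, 0 < u → 1 ≤ (ε / 96) ^ 2 * (K ^ 2 * u) →
      K ^ 2 * u * (x k ^ (-((2 - r) / 2)) / (n : ℝ) ^ 2) ≤ D →
      x k ^ (-((2 - r) / 2)) ≤ (ε / 96) ^ 2 * (n : ℝ) ^ 2 * D := by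
    intro u hu h1 h2
    have hy : 0 ≤ x k ^ (-((2 - r) / 2)) := Real.rpow_nonneg hxk.le _
    calc x k ^ (-((2 - r) / 2)) = 1 * x k ^ (-((2 - r) / 2)) := (one_mul _).symm
      _ ≤ (ε / 96) ^ 2 * (K ^ 2 * u) * x k ^ (-((2 - r) / 2)) := by gcongr
      _ = (ε / 96) ^ 2 * (n : ℝ) ^ 2 * (K ^ 2 * u * (x k ^ (-((2 - r) / 2)) / (n : ℝ) ^ 2)) := by
        field_simp
      _ ≤ _ := by gcongr
  refine hRq q (x k ^ (-((2 - r) / 2))) hwW ?_ ?_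
  · calc √S = 1 * √S := (one_mul _).symm
      _ ≤ ε / 96 * K ^ 2 * √S := by gcongr
      _ = ε / 96 * n * (K ^ 2 * (√S / n)) := by field_simp
      _ ≤ _ := by gcongr
  · rcases le_or_gt (cI / 2) ((n : ℝ) ^ 2 * S * x k ^ (2 - r)) with hd | hd
    · exact hfin _ (Real.sqrt_pos.2 (half_pos hc)) hK2
        (weight_le_of_head_rate hS0 hxk hn0 (half_pos hc) hd hDA)
    · have hd2 := (le_head_or_le_tail hc.le (by omega : 0 < n) hp hp0 hk hkI).resolve_left
        (not_le.2 hd)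
      have hT0 : 0 < T := by
        refine hT0.lt_of_ne' fun h => ?_
        rw [← hI, ← hT, h] at hd2
        linarith
      exact hfin _ (Real.rpow_pos_of_pos (half_pos hc) _) hK3
        (weight_le_of_tail_rate ht1 ht2 hS0 hT0 hxk hn0 (half_pos hc) hK0 hD0 hd.le hd2
          (hle _ hB0 (by rw [hrate]; linarith)))

/-- As `(n T + 1) / 2 ≤ max (n T) 1`, the tail term suffices when `n T ≥ 1` and the term `1 / n`
otherwise. -/
lemma le_rate_rpow {t T n ρ : ℝ} (ht1 : 1 ≤ t) (ht2 : t ≤ 2) (hT : 0 ≤ T) (hn : 0 < n)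
    (h1 : T ^ ((2 - t) / t) / n ^ ((2 * t - 2) / t) ≤ ρ) (h2 : 1 / n ≤ ρ) :
    ((n * T + 1) / 2) ^ (2 - t) / n ^ t ≤ ρ ^ t := by
  have ht0 : 0 < t := by linarith
  rcases le_total 1 (n * T) with h | h
  · have hT0 : 0 < T := by
      refine hT.lt_of_ne' fun h0 => ?_
      rw [h0] at h; linarith
    have e : (T ^ ((2 - t) / t) / n ^ ((2 * t - 2) / t)) ^ t = (n * T) ^ (2 - t) / n ^ t := by
      clear h1 h2 h
      obtain ⟨τ, rfl⟩ := exists_eq_exp hT0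
      obtain ⟨ν, rfl⟩ := exists_eq_exp hn
      simp only [← Real.exp_mul, ← Real.exp_add, ← Real.exp_sub]
      congr 1
      field_simp
      ring
    refine le_trans ?_ (Real.rpow_le_rpow (by positivity) h1 ht0.le)
    rw [e]
    gcongr
    linarith
  · refine le_trans ?_ (Real.rpow_le_rpow (by positivity) h2 ht0.le)
    rw [Real.div_rpow zero_le_one hn.le, Real.one_rpow]
    gcongr
    exact Real.rpow_le_one (by positivity) (by linarith) (by linarith)

lemma exists_tail_test {n N : ℕ} (hn : 2 ≤ n) {cI t ε K : ℝ} (hc : 0 < cI) (ht1 : 1 ≤ t)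
    (ht2 : t ≤ 2) (hε0 : 0 < ε) (hε1 : ε ≤ 1)
    (hK : 2 * (16 / ε + 2) + (√cI / (ε / 96) + 1 / (ε / 96) ^ 2) < K) (p : Fin N → unitInterval) :
    ∃ R : Set (Fin N → Fin n → Bool), (colLaw n p).real R ≤ 2 * ε ∧ ∀ q : Fin N → unitInterval,
      (K * rate cI t n fun j => (p j : ℝ)) ^ t ≤
        ∑ j ∈ tailSet N (cutoff cI n fun j => (p j : ℝ)), |(p j : ℝ) - q j| ^ t →
      (colLaw n q).real Rᶜ ≤ ε := by
  classical
  have hn0 : (0 : ℝ) < n := by exact_mod_cast (by omega : 0 < n)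
  have ht0 : 0 < t := by linarith
  have hp0 : ∀ j, 0 ≤ (p j : ℝ) := fun j => (p j).2.1
  have hrate := rate_eq cI t ht1 ht2 n hp0
  have hcut := sum_tailSet_cutoff_le hc.le n fun j => (p j : ℝ)
  set x : Fin N → ℝ := fun j => (p j : ℝ) with hx
  set I := cutoff cI n x with hI
  set T := ∑ j ∈ tailSet N I, x j with hT
  have hT0 : 0 ≤ T := Finset.sum_nonneg fun j _ => hp0 j
  have hA0 := Real.sqrt_nonneg
    ((∑ j ∈ headSet N I, x j ^ (2 * t / (4 - t))) ^ (1 / (2 * t / (4 - t))) / n)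
  have hB0 : 0 ≤ T ^ ((2 - t) / t) / (n : ℝ) ^ ((2 * t - 2) / t) := by positivity
  have hinv : 0 < 1 / (n : ℝ) := by positivity
  have hrate0 : 0 < rate cI t n x := by rw [hrate]; linarith
  have hρ := le_rate_rpow ht1 ht2 hT0 hn0 (ρ := rate cI t n x) (by rw [hrate]; linarith)
    (by rw [hrate]; linarith)
  set M := 16 / ε + 2 with hM
  set L := √cI / (ε / 96) + 1 / (ε / 96) ^ 2 with hL
  have hM2 : 2 ≤ M := by
    have : 0 < 16 / ε := by positivity
    linarith
  have hL0 : 0 < L := by positivity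
  let w : Fin N → ℝ := fun j => if j ∈ tailSet N I then 1 else 0
  have hw0 : ∀ j, 0 ≤ w j := fun j => by simp only [w]; split_ifs <;> norm_num
  have hw1 : ∀ j, w j ≤ 1 := fun j => by simp only [w]; split_ifs <;> norm_num
  have hV : ∑ j, w j ^ 2 * (p j : ℝ) ^ 2 ≤ (√cI / n) ^ 2 := by
    rw [div_pow, Real.sq_sqrt hc.le]
    refine le_trans (le_of_eq ?_) hcut
    rw [← Finset.univ_inter (tailSet N I), ← Finset.sum_ite_mem]
    exact Finset.sum_congr rfl fun j _ => by simp only [w]; split_ifs <;> simp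
  obtain ⟨R₁, hR₁, hq₁⟩ := exists_quadratic_test hn p w hw0
    (show 0 < √cI / n by positivity) hV hε0 hε1
  obtain ⟨R₂, hR₂, hq₂⟩ := exists_linear_test (by omega : 0 < n) p (tailSet N I) hε0 hε1
  refine ⟨R₁ ∪ R₂, (measureReal_union_le _ _).trans (by linarith), fun q hq => ?_⟩
  set D := ∑ j, w j * ((q j : ℝ) - p j) ^ 2 with hD
  have hD' : D = ∑ j ∈ tailSet N I, ((q j : ℝ) - p j) ^ 2 := by
    rw [hD, ← Finset.univ_inter (tailSet N I), ← Finset.sum_ite_mem]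
    exact Finset.sum_congr rfl fun j _ => by simp only [w]; split_ifs <;> simp
  have hDn : 0 ≤ D := Finset.sum_nonneg fun j _ => mul_nonneg (hw0 j) (sq_nonneg _)
  -- A large squared deviation is caught by the quadratic test; otherwise `D` is of order `1 / n²`
  -- and the linear test takes over.
  rcases le_or_gt L ((n : ℝ) ^ 2 * D) with hLD | hLD
  · refine (measureReal_mono (Set.compl_subset_compl.2 Set.subset_union_left)).trans
      (hq₁ q 1 hw1 ?_ ?_)
    · have h1 : √cI / (ε / 96) ≤ (n : ℝ) ^ 2 * D := by
        have : 0 < 1 / (ε / 96) ^ 2 := by positivity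
        linarith
      rw [div_le_iff₀ (by positivity)] at h1
      rw [div_le_iff₀ hn0]
      linarith
    · have h1 : 1 / (ε / 96) ^ 2 ≤ (n : ℝ) ^ 2 * D := by
        have : 0 < √cI / (ε / 96) := by positivity
        linarith
      rw [div_le_iff₀ (by positivity)] at h1
      linarith
  · refine (measureReal_mono (Set.compl_subset_compl.2 Set.subset_union_right)).trans (hq₂ q ?_)
    set E := ∑ j ∈ tailSet N I, |(q j : ℝ) - p j| with hE
    have hE0 : 0 ≤ E := Finset.sum_nonneg fun j _ => abs_nonneg _
    -- Downward deviations are at most `p j`, so `|q - p| ≤ (q - p) + 2 p`.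
    have hEle : E ≤ ∑ j ∈ tailSet N I, ((q j : ℝ) - p j) + 2 * T := by
      rw [hE, hT, Finset.mul_sum, ← Finset.sum_add_distrib]
      refine Finset.sum_le_sum fun j _ => ?_
      simp only [hx]
      rw [abs_le]
      constructor <;> linarith [(p j).2.1, (q j).2.1]
    have hhol : ∑ j ∈ tailSet N I, |x j - q j| ^ t ≤ E ^ (2 - t) * D ^ (t - 1) := by
      rw [hD', hE]
      refine le_trans (le_of_eq ?_) (sum_rpow_mul_rpow_le (tailSet N I)
        (fun j => |(q j : ℝ) - p j|) (fun j => ((q j : ℝ) - p j) ^ 2)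
        (fun j _ => abs_nonneg _) (fun j _ => sq_nonneg _) (by linarith) (by linarith) (by ring))
      refine Finset.sum_congr rfl fun j _ => ?_
      rw [← sq_abs, ← Real.rpow_natCast, ← Real.rpow_mul (abs_nonneg _),
        ← Real.rpow_add_of_nonneg (abs_nonneg _) (by linarith) (by push_cast; linarith),
        abs_sub_comm]
      congr 1
      push_cast; ring
    -- If both `E` and `D` were small, interpolation would put the `ℓ_t` deviation below `K` times
    -- the rate.
    have hnE : M * (n * T + 1) ≤ n * E := by
      by_contra hcon
      have h1 : E ≤ 2 * M * ((n * T + 1) / 2) / n := by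
        rw [le_div_iff₀ hn0]; linarith
      have h2 : D ≤ L / (n : ℝ) ^ 2 := by
        rw [le_div_iff₀ (by positivity)]; linarith
      have h3 : E ^ (2 - t) * D ^ (t - 1) ≤
          (2 * M * ((n * T + 1) / 2) / n) ^ (2 - t) * (L / (n : ℝ) ^ 2) ^ (t - 1) := by
        gcongr
      have h4 : (2 * M * ((n * T + 1) / 2) / n) ^ (2 - t) * (L / (n : ℝ) ^ 2) ^ (t - 1) =
          (2 * M) ^ (2 - t) * L ^ (t - 1) * (((n * T + 1) / 2) ^ (2 - t) / (n : ℝ) ^ t) := by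
        rw [mul_div_assoc, Real.mul_rpow (by positivity) (by positivity),
          Real.div_rpow (by positivity) hn0.le, Real.div_rpow hL0.le (by positivity),
          ← Real.rpow_natCast (n : ℝ) 2, ← Real.rpow_mul hn0.le]
        have : (n : ℝ) ^ t = (n : ℝ) ^ (2 - t) * (n : ℝ) ^ (((2 : ℕ) : ℝ) * (t - 1)) := by
          rw [← Real.rpow_add hn0]; congr 1; push_cast; ring
        rw [this]
        field_simp
      have h5 : (2 * M) ^ (2 - t) * L ^ (t - 1) ≤ (2 * M + L) ^ t := by
        calc (2 * M) ^ (2 - t) * L ^ (t - 1) ≤ (2 * M + L) ^ (2 - t) * (2 * M + L) ^ (t - 1) := by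
              gcongr <;> linarith
          _ = (2 * M + L) ^ (1 : ℝ) := by
              rw [← Real.rpow_add (by positivity)]; congr 1; ring
          _ ≤ _ := Real.rpow_le_rpow_of_exponent_le (by linarith) ht1
      have h6 : (2 * M + L) ^ t < K ^ t := Real.rpow_lt_rpow (by positivity) hK ht0
      have hrt : 0 < rate cI t n x ^ t := Real.rpow_pos_of_pos hrate0 t
      have h7 : (K * rate cI t n x) ^ t ≤ (2 * M + L) ^ t * rate cI t n x ^ t := by
        refine hq.trans (hhol.trans (h3.trans ?_))
        rw [h4]
        gcongr
      rw [Real.mul_rpow (by linarith) hrate0.le] at h7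
      exact absurd (le_of_mul_le_mul_right h7 hrt) (not_le.2 h6)
    have h8 : n * E ≤ n * (∑ j ∈ tailSet N I, ((q j : ℝ) - p j) + 2 * T) := by gcongr
    have h9 : M * (n * T + 1) = 16 / ε * (n * T + 1) + 2 * (n * T + 1) := by rw [hM]; ring
    linarith

/-- The upper bound on the separation radius. -/
lemma separationRadius_le_rate {η : ℝ} (hη₀ : 0 < η) (hη₁ : η < 1) {cI t : ℝ} (hc : 0 < cI)
    (ht1 : 1 ≤ t) (ht2 : t ≤ 2) :
    ∃ C : ℝ, 0 < C ∧ ∀ n N : ℕ, 2 ≤ n → ∀ (p : Fin N → unitInterval)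
      (σ : Equiv.Perm (Fin N)), Antitone (reduced p σ) →
        separationRadius n t η p ≤ C * rate cI t n (reduced p σ) := by
  have ht0 : 0 < t := by linarith
  -- The null errors are `ε` for the head and `2 ε` for the tail, in total `η / 2`.
  set ε := η / 6 with hε
  have hε0 : 0 < ε := by positivity
  have hε1 : ε ≤ 1 := by linarith
  set κ := ε / 96 with hκ
  have hκ0 : 0 < κ := by positivity
  set L := 2 * (16 / ε + 2) + (√cI / κ + 1 / κ ^ 2) with hL
  have hL0 : 0 < L := by positivity
  set a := √(cI / 2) with ha
  have ha0 : 0 < a := by positivity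
  set b := (cI / 2) ^ ((2 - t) / t) with hb
  have hb0 : 0 < b := by positivity
  set K := 1 + L + 1 / κ + 1 / (κ ^ 2 * a) + 1 / (κ ^ 2 * b) with hK
  have k1 : 0 < 1 / κ := by positivity
  have k2 : 0 < 1 / (κ ^ 2 * a) := by positivity
  have k3 : 0 < 1 / (κ ^ 2 * b) := by positivity
  have hK1 : 1 ≤ K := by linarith
  have hKsq : ∀ u, 0 < u → 1 / u ≤ K → 1 ≤ u * K ^ 2 := fun u hu h => by
    rw [div_le_iff₀ hu] at h
    have : u * K ≤ u * K ^ 2 := by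
      gcongr; exact le_self_pow₀ hK1 two_ne_zero
    linarith
  refine ⟨2 * K, by positivity, fun n N hn p σ hp => ?_⟩
  have hn0 : (0 : ℝ) < n := by exact_mod_cast (by omega : 0 < n)
  set f := flipPattern p σ
  set p' := paramEquiv σ f p with hp'
  have hp'x : (fun j => (p' j : ℝ)) = reduced p σ := funext (coe_paramEquiv_flipPattern p σ)
  rw [← hp'x] at hp ⊢
  have hrate0 : 0 < rate cI t n fun j => (p' j : ℝ) :=
    add_pos_of_nonneg_of_pos (add_nonneg (Real.sqrt_nonneg _)
      (div_nonneg (Real.rpow_nonneg (lpNorm_nonneg _ _) _) (by positivity))) (by positivity)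
  obtain ⟨R₁, hR₁, hq₁⟩ := exists_head_test hn hc ht1 ht2 hε0 hε1 (by linarith : 0 < K)
    (hKsq κ hκ0 (by linarith)) (by
      have := hKsq (κ ^ 2 * a) (by positivity) (by linarith)
      rw [hκ, ha] at this
      linarith) (by
      have := hKsq (κ ^ 2 * b) (by positivity) (by linarith)
      rw [hκ, hb] at this
      linarith) p' hp
  obtain ⟨R₂, hR₂, hq₂⟩ := exists_tail_test hn hc ht1 ht2 hε0 hε1 (by linarith : L < K) p'
  set ρ := rate cI t n fun j => (p' j : ℝ)
  have hKρ : 0 < K * ρ := by positivity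
  refine separationRadius_le (by positivity) ?_
  have := minimaxRisk_le_of_region (n := n) t (2 * K * ρ) (η / 2) (by positivity) p σ f (R₁ ∪ R₂)
    ((measureReal_union_le _ _).trans (by linarith)) fun q hq => ?_
  · linarith
  · have h1 : (2 * K * ρ) ^ t ≤ ∑ j, |(p' j : ℝ) - q j| ^ t := by
      rw [← lpNorm_rpow ht0.ne']
      exact Real.rpow_le_rpow (by positivity) hq ht0.le
    -- As `t ≥ 1`, doubling the radius at least doubles its `t`-th power, so the head or the tail
    -- alone carries `(K ρ) ^ t`.
    have h2 : 2 * (K * ρ) ^ t ≤ (2 * K * ρ) ^ t := by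
      rw [mul_assoc, Real.mul_rpow zero_le_two hKρ.le]
      gcongr
      simpa using Real.rpow_le_rpow_of_exponent_le one_le_two ht1
    rw [← sum_headSet_add_sum_tailSet (cutoff cI n fun j => (p' j : ℝ))] at h1
    rcases le_or_gt ((K * ρ) ^ t) (∑ j ∈ headSet N (cutoff cI n fun j => (p' j : ℝ)),
      |(p' j : ℝ) - q j| ^ t) with h | h
    · refine (measureReal_mono (Set.compl_subset_compl.2 Set.subset_union_left)).trans
        ((hq₁ q h).trans (by linarith))
    · refine (measureReal_mono (Set.compl_subset_compl.2 Set.subset_union_right)).trans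
        ((hq₂ q (by linarith)).trans (by linarith))

end

end BinomialTesting

theorem mainTheorem1 (η : ℝ) (hη₀ : 0 < η) (hη₁ : η < 1) :
    ∃ c₀ : ℝ, 0 < c₀ ∧ ∀ cI : ℝ, 0 < cI → cI ≤ c₀ →
      ∀ t : ℝ, 1 ≤ t → t ≤ 2 →
        ∃ c C : ℝ, 0 < c ∧ 0 < C ∧
          ∀ (n N : ℕ), 2 ≤ n → 2 ≤ N →
            ∀ (p : Fin N → unitInterval) (σ : Equiv.Perm (Fin N)),
              Antitone (BinomialTesting.reduced p σ) →
                c * BinomialTesting.rate cI t n (BinomialTesting.reduced p σ) ≤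
                    BinomialTesting.separationRadius n t η p ∧
                  BinomialTesting.separationRadius n t η p ≤
                    C * BinomialTesting.rate cI t n (BinomialTesting.reduced p σ) := by
  -- The sparse prior gives risk at least `1 - 36 cI`, which has to exceed `η`.
  refine ⟨(1 - η) / 72, by linarith, fun cI hc hc0 t ht1 ht2 => ?_⟩
  obtain ⟨c, hc', hlow⟩ := BinomialTesting.rate_le_separationRadius hη₀ hη₁ hc hc0 ht1 ht2
  obtain ⟨C, hC, hup⟩ := BinomialTesting.separationRadius_le_rate hη₀ hη₁ hc ht1 ht2
  exact ⟨c, C, hc', hC, fun n N hn hN p σ hp => ⟨hlow n N hn hN p σ hp, hup n N hn p σ hp⟩⟩
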